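/- Let $\beta\in\{1,2\}$, let $d\in(0,1)$, and for every integer $M\ge 1$ let $N=N(M)$ be an integer with $0\le N\le M$ such that $\mathfrak d:=N/M\to d$ as $M\to\infty$. Let $\chi_k$ denote the chi distribution with $k$ degrees of freedom (the law of the Euclidean norm of a vector of $k$ independent standard real normal variables). For each $M$ let $H=H_M$ be a random real $N\times N$ lower bidiagonal matrix, with diagonal entries $\alpha_j=H_{j+1,j+1}$ $(0\le j\le N-1)$ and subdiagonal entries $\beta_j=H_{j+2,j+1}$ $(0\le j\le N-2)$, all of which are independent, where $$\sqrt{\beta M}\,\alpha_j\ \text{ has law }\ \chi_{\beta(M-j)},\qquad \sqrt{\beta M}\,\beta_j\ \text{ has law }\ \chi_{\beta(N-j-1)} .$$ (For different $M$ the matrices may live on different probability spaces.) Put $T=HH^*$, and let $\vec f_1$ be the first standard basis vector of $\mathbb R^N$. Let $Z_1,Z_2,\dots$ be iid standard normal random variables. Then the series in $$Z_{-1}:=-\sqrt2\,\frac{Z_1}{1-d}+\sqrt2\sum_{k=1}^\infty\frac{d^k}{1-d}\Bigl(\frac{Z_{2k}}{\sqrt d}-Z_{2k+1}\Bigr)$$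 converges almost surely (absolutely), and, as $M\to\infty$, $$\sqrt{\beta M}\Bigl(\vec f_1^*T^{-1}\vec f_1-\frac1{1-\mathfrak d}\Bigr)\longrightarrow Z_{-1}\quad\text{in distribution.}$$ Moreover, jointly, $$\sqrt{\beta M}\left(\begin{bmatrix}\vec f_1^*T^{-1}\vec f_1\\ \alpha_0\\ \beta_0\\ \alpha_1\\ \beta_1\\ \vdots\end{bmatrix}-\begin{bmatrix}\frac1{1-\mathfrak d}\\ 1\\ \sqrt{\mathfrak d}\\ 1\\ \sqrt{\mathfrak d}\\ \vdots\end{bmatrix}\right)\longrightarrow\begin{bmatrix}Z_{-1}\\ Z_1/\sqrt2\\ Z_2/\sqrt2\\ Z_3/\sqrt2\\ Z_4/\sqrt2\\ \vdots\end{bmatrix}$$ in the sense of convergence of finite-dimensional marginals: for every finite set $S$ of coordinates, the subvector indexed by $S$ converges in distribution to the corresponding subvector of the right-hand side. (Each fixed coordinate is defined for all large $M$, since $N\to\infty$.) -/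

import Mathlib

open MeasureTheory ProbabilityTheory Filter Topology

noncomputable section

namespace Bidiagonal

/-- The chi distribution with `k` degrees of freedom: the law of the Euclidean norm of a vector of
`k` independent standard real normal random variables. -/
def chiMeasure (k : ℕ) : Measure ℝ :=
  (Measure.pi (fun _ : Fin k => gaussianReal 0 1)).map (fun x => √(∑ i, x i ^ 2))

/-- The law of `χ_k / √(βM)`, where `χ_k` is chi-distributed with `k` degrees of freedom. -/
def scaledChiMeasure (β M k : ℕ) : Measure ℝ :=
  (chiMeasure k).map (fun x => x / √((β : ℝ) * M))

/-- The law of the `(i, j)` entry (rows and columns numbered from `0`) of the `N × N` random lower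
bidiagonal matrix
`(βM)^{-1/2} * [χ_{βM}; χ_{β(N-1)}, χ_{β(M-1)}; χ_{β(N-2)}, χ_{β(M-2)}; …; χ_β, χ_{β(M-N+1)}]`:
the `(j, j)` entry is `χ_{β(M-j)} / √(βM)`, the `(j+1, j)` entry is `χ_{β(N-j-1)} / √(βM)`, and all
other entries vanish. -/
def entryLaw (β N M : ℕ) (i j : Fin N) : Measure ℝ :=
  if i = j then scaledChiMeasure β M (β * (M - j))
  else if (i : ℕ) = j + 1 then scaledChiMeasure β M (β * (N - j - 1))
  else Measure.dirac 0

/-- The random matrix `H` is distributed as the chi bidiagonal matrix: its entries are independent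
with the laws `entryLaw`. -/
structure IsChiBidiagonal {Ω : Type*} [MeasurableSpace Ω] (P : Measure Ω) (β N M : ℕ)
    (H : Ω → Matrix (Fin N) (Fin N) ℝ) : Prop where
  hasLaw : ∀ i j, HasLaw (fun ω => H ω i j) (entryLaw β N M i j) P
  indep : iIndepFun (fun (p : Fin N × Fin N) ω => H ω p.1 p.2) P

/-- The diagonal entry `α_j = H_{j,j}` (numbered from `0`); irrelevant value `0` if `j ≥ N`. -/
def alphaEntry {N : ℕ} (H : Matrix (Fin N) (Fin N) ℝ) (j : ℕ) : ℝ :=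
  if h : j < N then H ⟨j, h⟩ ⟨j, h⟩ else 0

/-- The subdiagonal entry `β_j = H_{j+1,j}` (numbered from `0`); irrelevant value `0` if
`j + 1 ≥ N`. -/
def betaEntry {N : ℕ} (H : Matrix (Fin N) (Fin N) ℝ) (j : ℕ) : ℝ :=
  if h : j + 1 < N then H ⟨j + 1, h⟩ ⟨j, Nat.lt_of_succ_lt h⟩ else 0

/-- The first standard basis vector of `ℝ^N`. -/
def firstBasis (N : ℕ) : Fin N → ℝ := fun i => if (i : ℕ) = 0 then 1 else 0

/-- The number `f₁* T⁻¹ f₁` for `T = H Hᵀ`. -/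
def invCorner {N : ℕ} (H : Matrix (Fin N) (Fin N) ℝ) : ℝ :=
  firstBasis N ⬝ᵥ Matrix.mulVec (H * H.transpose)⁻¹ (firstBasis N)

/-- The rescaled vector
`√(βM) * ((f₁* T⁻¹ f₁, α₀, β₀, α₁, β₁, …) - (1 / (1 - 𝔡), 1, √𝔡, 1, √𝔡, …))`, `𝔡 = N / M`,
with coordinates numbered from `0`, so that `α_j` stands at place `2j + 1` and `β_j` at `2j + 2`. -/
def fluctuation (β M : ℕ) {N : ℕ} (H : Matrix (Fin N) (Fin N) ℝ) : ℕ → ℝ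
  | 0 => √((β : ℝ) * M) * (invCorner H - 1 / (1 - (N : ℝ) / M))
  | n + 1 =>
    if n % 2 = 0 then √((β : ℝ) * M) * (alphaEntry H (n / 2) - 1)
    else √((β : ℝ) * M) * (betaEntry H (n / 2) - √((N : ℝ) / M))

/-- The `k`-th summand `d^k / (1 - d) * (Z_{2k} / √d - Z_{2k+1})`. -/
def limitTerm (d : ℝ) (z : ℕ → ℝ) (k : ℕ) : ℝ :=
  d ^ k / (1 - d) * (z (2 * k) / √d - z (2 * k + 1))

/-- `Z_{-1} = -√2 Z₁ / (1 - d) + √2 ∑_{k ≥ 1} d^k / (1 - d) * (Z_{2k} / √d - Z_{2k+1})`. -/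
def limitCorner (d : ℝ) (z : ℕ → ℝ) : ℝ :=
  -√2 * (z 1 / (1 - d)) + √2 * ∑' k : ℕ, limitTerm d z (k + 1)

/-- The limit vector `(Z_{-1}, Z₁ / √2, Z₂ / √2, …)`, with coordinates numbered from `0`. -/
def limitVector (d : ℝ) (z : ℕ → ℝ) : ℕ → ℝ
  | 0 => limitCorner d z
  | n + 1 => z (n + 1) / √2

end Bidiagonal

end

/-!
Let `α_j` and `β_j` be the diagonal and subdiagonal entries of `H`, and put `𝔡 = N / M`,
`r_l = β_l² / α_{l+1}²`, `p_l = r_0 ⋯ r_{l-1}` and `c = 1 / (1 - 𝔡)`. Since `H` is bidiagonal, the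
equation `H x = f₁` is solved by recursion, and `f₁* T⁻¹ f₁ = |x|² = α_0⁻² ∑_{j < N} p_j`
(`invCorner_eq`). Comparing the sum with the geometric series gives the exact identity
`∑_{j ≤ n} p_j - c = c ∑_{l < n} p_l (r_l - 𝔡) + p_n (1 - c)` (`sum_prod_sub`). On the scale `√(βM)`,
each `r_l - 𝔡` fluctuates at order one, while `α_0 → 1` and `p_l → d^l`. This is where the limiting
series comes from.

*Truncation to `L` terms.* With `α_j = 1 + ε a_j`, `β_j = √𝔡 + ε b_j` and `ε = 1 / √(βM)`, the first
`L` terms of the identity are a function of the fluctuations `a_j`, `b_j` and of `ε` that is regular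
at `ε = 0` (`truncCorner`). Replacing each inverse `1 / x` by `1 / max x κ` makes it continuous
everywhere, so the continuous mapping theorem applies without a delta method. The fluctuations
themselves are independent and converge to `Z / √2`: this is the central limit theorem for a sum of
squares of standard normal variables, followed by a square root (`tendstoInDistribution_chi`).

*The remaining terms.* A Chernoff bound and a union bound show that, outside an event of exponentially
small probability, all `α_j²` are at least `κ` and all `r_l` are at most some `ρ < 1`
(`IsChiBidiagonal.measureReal_not_isTame_le`). There the terms from `L` on are bounded by
`∑_{l ≥ L} ρ^l D_l`, up to a constant and a vanishing error, where `D_l` has expectation `O(l + 1)`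
uniformly in `M`; this is small in probability for large `L`
(`IsChiBidiagonal.measureReal_corner_sub_truncCorner_le`).

The two parts are combined by an approximation criterion for convergence in distribution that allows
the probability space to vary (`tendstoInDistribution_of_approx`).
-/

namespace Bidiagonal

/-! ### Convergence in distribution on varying probability spaces -/

section Convergence

variable {Ω : ℕ → Type*} {mΩ : ∀ n, MeasurableSpace (Ω n)} {P : ∀ n, Measure (Ω n)}
  [∀ n, IsProbabilityMeasure (P n)] {Ω' : Type*} {mΩ' : MeasurableSpace Ω'} {Q : Measure Ω'}
  [IsProbabilityMeasure Q]

/-- Convergence in distribution is tested on bounded Lipschitz functions, with the expectations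
written on the varying probability spaces. -/
theorem tendstoInDistribution_iff_lipschitz {E : Type*} [PseudoMetricSpace E] [MeasurableSpace E]
    [BorelSpace E] {Y : ∀ n, Ω n → E} {Z : Ω' → E}
    (hY : ∀ n, AEMeasurable (Y n) (P n)) (hZ : AEMeasurable Z Q) :
    TendstoInDistribution Y atTop Z P Q ↔
      ∀ f : E → ℝ, (∃ C : ℝ, ∀ x y, dist (f x) (f y) ≤ C) → (∃ K, LipschitzWith K f) →
        Tendsto (fun n => ∫ ω, f (Y n ω) ∂P n) atTop (𝓝 (∫ ω, f (Z ω) ∂Q)) := by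
  have key : ∀ f : E → ℝ, (∃ K, LipschitzWith K f) →
      ((fun n => ∫ x, f x ∂((P n).map (Y n))) = fun n => ∫ ω, f (Y n ω) ∂P n) ∧
      ∫ x, f x ∂(Q.map Z) = ∫ ω, f (Z ω) ∂Q := by
    rintro f ⟨K, hK⟩
    have hf : Measurable f := hK.continuous.measurable
    exact ⟨funext fun n => integral_map (hY n) hf.aestronglyMeasurable,
      integral_map hZ hf.aestronglyMeasurable⟩
  constructor
  · intro h f hb hl
    have := tendsto_iff_forall_lipschitz_integral_tendsto.1 h.tendsto f hb hl
    simp only [ProbabilityMeasure.coe_mk] at this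
    rwa [(key f hl).1, (key f hl).2] at this
  · intro h
    refine ⟨hY, hZ, tendsto_iff_forall_lipschitz_integral_tendsto.2 fun f hb hl => ?_⟩
    simp only [ProbabilityMeasure.coe_mk]
    rw [(key f hl).1, (key f hl).2]
    exact h f hb hl

theorem abs_integral_sub_integral_le {Ω : Type*} [MeasurableSpace Ω] {P : Measure Ω}
    [IsProbabilityMeasure P] {E : Type*} [PseudoMetricSpace E] [MeasurableSpace E]
    [BorelSpace E] [SecondCountableTopology E] {X Y : Ω → E} (hX : AEMeasurable X P)
    (hY : AEMeasurable Y P) {f : E → ℝ} {C : ℝ} (hC : ∀ x y, dist (f x) (f y) ≤ C)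
    {K : NNReal} (hK : LipschitzWith K f) {ε : ℝ} (hε : 0 ≤ ε) :
    |∫ ω, f (X ω) ∂P - ∫ ω, f (Y ω) ∂P| ≤
      K * ε + C * P.real {ω | ε ≤ dist (X ω) (Y ω)} := by
  obtain ⟨ω₀⟩ : Nonempty Ω := nonempty_of_isProbabilityMeasure P
  have hf : Measurable f := hK.continuous.measurable
  have hC0 : 0 ≤ C := dist_nonneg.trans (hC (X ω₀) (X ω₀))
  have hint : ∀ V : Ω → E, AEMeasurable V P → Integrable (fun ω => f (V ω)) P := fun V hV => by
    refine Integrable.of_bound (hf.comp_aemeasurable hV).aestronglyMeasurable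
      (‖f (X ω₀)‖ + C) (ae_of_all _ fun ω => ?_)
    have h1 := hC (V ω) (X ω₀)
    have h2 := norm_sub_norm_le (f (V ω)) (f (X ω₀))
    rw [dist_eq_norm] at h1
    linarith
  have hs : NullMeasurableSet {ω | ε ≤ dist (X ω) (Y ω)} P :=
    nullMeasurableSet_le aemeasurable_const (hX.dist hY)
  have hind : Integrable ({ω | ε ≤ dist (X ω) (Y ω)}.indicator fun _ => C) P :=
    (integrable_const C).indicator₀ hs
  rw [← integral_sub (hint X hX) (hint Y hY)]
  calc |∫ ω, (f (X ω) - f (Y ω)) ∂P| ≤ ∫ ω, |f (X ω) - f (Y ω)| ∂P := abs_integral_le_integral_abs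
    _ ≤ ∫ ω, (K * ε + {ω | ε ≤ dist (X ω) (Y ω)}.indicator (fun _ => C) ω) ∂P := by
        refine integral_mono ((hint X hX).sub (hint Y hY)).abs ((integrable_const _).add hind)
          fun ω => ?_
        have h1 : |f (X ω) - f (Y ω)| ≤ C := hC _ _
        have h2 : |f (X ω) - f (Y ω)| ≤ K * dist (X ω) (Y ω) := hK.dist_le_mul _ _
        by_cases h : ε ≤ dist (X ω) (Y ω)
        · have : {ω | ε ≤ dist (X ω) (Y ω)}.indicator (fun _ => C) ω = C :=
            Set.indicator_of_mem (s := {ω | ε ≤ dist (X ω) (Y ω)}) h _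
          simp only [this]
          have : 0 ≤ (K : ℝ) * ε := by positivity
          linarith
        · have : {ω | ε ≤ dist (X ω) (Y ω)}.indicator (fun _ => C) ω = 0 :=
            Set.indicator_of_notMem (s := {ω | ε ≤ dist (X ω) (Y ω)}) h _
          simp only [this, add_zero]
          exact h2.trans (by gcongr; exact (not_le.1 h).le)
    _ = K * ε + C * P.real {ω | ε ≤ dist (X ω) (Y ω)} := by
        rw [integral_add (integrable_const _) hind, integral_indicator₀ hs]
        simp [mul_comm]

/-- Approximation criterion: if `U L n ⇒ T L` as `n → ∞`, `T L → Z` almost surely as `L → ∞`, and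
`U L n` is close to `Y n` in probability, for large `L` and then for large `n`, then `Y n ⇒ Z`. The
probability space may vary with `n`. -/
theorem tendstoInDistribution_of_approx {E : Type*} [PseudoMetricSpace E] [MeasurableSpace E]
    [BorelSpace E] [SecondCountableTopology E]
    {U : ℕ → ∀ n, Ω n → E} {T : ℕ → Ω' → E} {Y : ∀ n, Ω n → E} {Z : Ω' → E}
    (hY : ∀ n, AEMeasurable (Y n) (P n)) (hZ : AEMeasurable Z Q)
    (hU : ∀ L, TendstoInDistribution (U L) atTop (T L) P Q)
    (hT : ∀ᵐ ω ∂Q, Tendsto (fun L => T L ω) atTop (𝓝 (Z ω)))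
    (happ : ∀ ε > 0, ∀ᶠ L in atTop, ∀ᶠ n in atTop,
      (P n).real {ω | ε ≤ dist (U L n ω) (Y n ω)} ≤ ε) :
    TendstoInDistribution Y atTop Z P Q := by
  have hTZ : TendstoInDistribution T atTop Z (fun _ => Q) Q :=
    tendstoInDistribution_of_ae_tendsto (fun L => (hU L).aemeasurable_limit) hZ hT
  rw [tendstoInDistribution_iff_lipschitz hTZ.forall_aemeasurable hZ] at hTZ
  rw [tendstoInDistribution_iff_lipschitz hY hZ]
  rintro f ⟨C, hC⟩ ⟨K, hK⟩
  have hTZ := hTZ f ⟨C, hC⟩ ⟨K, hK⟩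
  rw [Metric.tendsto_nhds] at hTZ ⊢
  intro η hη
  obtain ⟨ω₀⟩ : Nonempty Ω' := nonempty_of_isProbabilityMeasure Q
  have hC0 : 0 ≤ C := dist_nonneg.trans (hC (Z ω₀) (Z ω₀))
  have hKC : 0 < (K : ℝ) + C + 1 := by positivity
  set ε := η / 3 / (K + C + 1) with hε
  have hεpos : 0 < ε := by positivity
  obtain ⟨L, hL1, hL2⟩ := ((hTZ (η / 3) (by positivity)).and (happ ε hεpos)).exists
  have hUL := (tendstoInDistribution_iff_lipschitz (hU L).forall_aemeasurable
    (hU L).aemeasurable_limit).1 (hU L) f ⟨C, hC⟩ ⟨K, hK⟩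
  rw [Metric.tendsto_nhds] at hUL
  filter_upwards [hL2, hUL (η / 3) (by positivity)] with n hn1 hn2
  have h := abs_integral_sub_integral_le ((hU L).forall_aemeasurable n) (hY n) hC hK hεpos.le
  have h' : (K : ℝ) * ε + C * (P n).real {ω | ε ≤ dist (U L n ω) (Y n ω)} ≤ η / 3 := by
    calc _ ≤ (K : ℝ) * ε + C * ε := by gcongr
      _ ≤ (K + C + 1) * ε := by nlinarith
      _ = η / 3 := by rw [hε]; field_simp
  rw [Real.dist_eq] at *
  have e1 := abs_le.1 (h.trans h')
  have e2 := abs_lt.1 hn2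
  have e3 := abs_lt.1 hL1
  rw [abs_lt]
  constructor <;> linarith [e1.1, e1.2, e2.1, e2.2, e3.1, e3.2]

/-- Slutsky's theorem for deterministic second components and varying probability spaces. -/
theorem tendstoInDistribution_prodMk_const {E F : Type*}
    [PseudoMetricSpace E] [MeasurableSpace E] [BorelSpace E] [SecondCountableTopology E]
    [PseudoMetricSpace F] [MeasurableSpace F] [BorelSpace F] [SecondCountableTopology F]
    {X : ∀ n, Ω n → E} {Z : Ω' → E} (h : TendstoInDistribution X atTop Z P Q)
    {c : ℕ → F} {c₀ : F} (hc : Tendsto c atTop (𝓝 c₀)) :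
    TendstoInDistribution (fun n ω => (X n ω, c n)) atTop (fun ω => (Z ω, c₀)) P Q := by
  refine tendstoInDistribution_of_approx (U := fun _ n ω => (X n ω, c₀))
    (T := fun _ ω => (Z ω, c₀)) (fun n => (h.forall_aemeasurable n).prodMk aemeasurable_const)
    (h.aemeasurable_limit.prodMk aemeasurable_const)
    (fun _ => h.continuous_comp (g := fun x => (x, c₀)) (by fun_prop))
    (ae_of_all _ fun ω => tendsto_const_nhds) fun ε hε => Eventually.of_forall fun _ => ?_
  filter_upwards [Metric.tendsto_nhds.1 hc ε hε] with n hn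
  have : {ω : Ω n | ε ≤ dist (X n ω, c₀) (X n ω, c n)} = ∅ := by
    refine Set.eq_empty_of_forall_notMem fun ω hω => (not_le.2 ?_) (Set.mem_ofPred_eq ▸ hω)
    rw [Prod.dist_eq, dist_self, dist_comm c₀]
    exact max_lt hε hn
  rw [this, measureReal_empty]
  exact hε.le

/-- Coordinatewise convergence in distribution is joint as soon as the coordinates are eventually
independent and so are those of the limit. -/
theorem tendstoInDistribution_pi {ι : Type*} [Fintype ι] {X : ∀ n, Ω n → ι → ℝ} {Z : Ω' → ι → ℝ}
    (hX : ∀ i, TendstoInDistribution (fun n ω => X n ω i) atTop (fun ω => Z ω i) P Q)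
    (hind : ∀ᶠ n in atTop, iIndepFun (fun i ω => X n ω i) (P n))
    (hindZ : iIndepFun (fun i ω => Z ω i) Q) :
    TendstoInDistribution X atTop Z P Q where
  forall_aemeasurable n := aemeasurable_pi_iff.2 fun i => (hX i).forall_aemeasurable n
  aemeasurable_limit := aemeasurable_pi_iff.2 fun i => (hX i).aemeasurable_limit
  tendsto := by
    have key := (ProbabilityMeasure.continuous_pi (ι := ι) (α := fun _ => ℝ)).tendsto
      (fun i => ⟨Q.map fun ω => Z ω i,
        Measure.isProbabilityMeasure_map (hX i).aemeasurable_limit⟩)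
    have h2 := key.comp (tendsto_pi_nhds.2 fun i => (hX i).tendsto)
    have e : (⟨Q.map Z, Measure.isProbabilityMeasure_map
        (aemeasurable_pi_iff.2 fun i => (hX i).aemeasurable_limit)⟩ :
        ProbabilityMeasure (ι → ℝ)) = ProbabilityMeasure.pi (fun i => ⟨Q.map fun ω => Z ω i,
        Measure.isProbabilityMeasure_map (hX i).aemeasurable_limit⟩) :=
      Subtype.ext ((iIndepFun_iff_map_fun_eq_pi_map fun i => (hX i).aemeasurable_limit).1 hindZ)
    rw [e]
    refine h2.congr' ?_
    filter_upwards [hind] with n hn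
    exact (Subtype.ext ((iIndepFun_iff_map_fun_eq_pi_map
      fun i => (hX i).forall_aemeasurable n).1 hn)).symm

end Convergence

/-! ### Sums of squares of standard normal variables -/

/-- The law of a sequence of independent standard normal random variables. -/
noncomputable def gaussSeq : Measure (ℕ → ℝ) := Measure.infinitePi fun _ => gaussianReal 0 1

instance : IsProbabilityMeasure gaussSeq := by unfold gaussSeq; infer_instance

/-- The sum of the squares of the first `k` terms of a sequence. -/
def sumSq (k : ℕ) (g : ℕ → ℝ) : ℝ := ∑ i ∈ Finset.range k, g i ^ 2

lemma sumSq_nonneg (k : ℕ) (g : ℕ → ℝ) : 0 ≤ sumSq k g := Finset.sum_nonneg fun _ _ => sq_nonneg _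

@[fun_prop]
lemma measurable_sumSq (k : ℕ) : Measurable (sumSq k) := by unfold sumSq; fun_prop

lemma iIndepFun_eval_gaussSeq : iIndepFun (fun (i : ℕ) (g : ℕ → ℝ) => g i) gaussSeq :=
  iIndepFun_infinitePi (P := fun _ => gaussianReal 0 1) (X := fun _ x => x) fun _ => measurable_id

lemma map_eval_gaussSeq (i : ℕ) : gaussSeq.map (fun g => g i) = gaussianReal 0 1 :=
  Measure.infinitePi_map_eval (fun _ => gaussianReal 0 1) i

lemma chiMeasure_eq_map (k : ℕ) : chiMeasure k = gaussSeq.map fun g => √(sumSq k g) := by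
  have h := (iIndepFun_iff_map_fun_eq_pi_map fun i : Fin k => (measurable_pi_apply (i : ℕ)).aemeasurable).1
    (iIndepFun_eval_gaussSeq.precomp (g := fun i : Fin k => (i : ℕ)) Fin.val_injective)
  simp only [map_eval_gaussSeq] at h
  rw [chiMeasure, ← h, Measure.map_map (by fun_prop) (by fun_prop)]
  congr 1
  funext g
  simp [sumSq, Finset.sum_range]

/-- The fourth moment is the fourth derivative at `0` of the moment generating function
`exp (t² / 2)`. -/
lemma integral_pow_four_gaussianReal : ∫ x, x ^ 4 ∂gaussianReal 0 1 = 3 := by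
  have h := iteratedDeriv_mgf_zero (X := id) (μ := gaussianReal 0 1)
    (by simp [integrableExpSet_id_gaussianReal]) 4
  simp only [Pi.pow_apply, id_eq] at h
  rw [← h, mgf_id_gaussianReal]
  -- Each differentiation turns `p(t) exp (t² / 2)` into `(p'(t) + t p(t)) exp (t² / 2)`.
  have d : ∀ (p q : ℝ → ℝ), (∀ t, HasDerivAt p (q t) t) →
      deriv (fun t => p t * Real.exp (t ^ 2 / 2)) =
        fun t => (q t + t * p t) * Real.exp (t ^ 2 / 2) := by
    intro p q hpq
    funext t
    have h1 : HasDerivAt (fun t : ℝ => Real.exp (t ^ 2 / 2)) (Real.exp (t ^ 2 / 2) * t) t := by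
      refine (((hasDerivAt_pow 2 t).div_const 2).congr_deriv ?_).exp
      norm_num
    exact (((hpq t).mul h1).congr_deriv (by ring)).deriv
  have e0 : (fun t : ℝ => Real.exp (0 * t + ((1 : NNReal) : ℝ) * t ^ 2 / 2)) =
      fun t => 1 * Real.exp (t ^ 2 / 2) := by funext t; simp
  rw [e0]
  simp only [iteratedDeriv_succ', iteratedDeriv_zero]
  rw [d (fun _ => 1) (fun _ => 0) fun t => hasDerivAt_const t 1,
    d _ (fun _ => 1) fun t => (hasDerivAt_id' t).congr_of_eventuallyEq (Eventually.of_forall fun t => by simp),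
    d _ (fun t => 2 * t) fun t => by
      have := ((hasDerivAt_id t).mul (hasDerivAt_id t)).const_add (1 : ℝ)
      simp only [zero_add, mul_one] at this ⊢
      exact this.congr_deriv (by simp; ring),
    d _ (fun t => 3 + 3 * t ^ 2) fun t => by
      have h1 : HasDerivAt (fun t : ℝ => 3 * t + t ^ 3) (3 + 3 * t ^ 2) t :=
        (((hasDerivAt_id t).const_mul 3).add (hasDerivAt_pow 3 t)).congr_deriv (by simp)
      refine h1.congr_of_eventuallyEq (Eventually.of_forall fun t => ?_)
      simp; ring]
  simp

lemma memLp_sq_gaussianReal : MemLp (fun x : ℝ => x ^ 2) 2 (gaussianReal 0 1) := by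
  have h := (memLp_id_gaussianReal' (μ := 0) (v := 1) 4 (by simp)).norm_rpow_div 2
  have e : (4 : ENNReal) / 2 = 2 := by
    rw [show (4 : ENNReal) = 2 * 2 by norm_num]
    exact ENNReal.mul_div_cancel_right (by simp) (by simp)
  rw [e] at h
  simpa using h

lemma integral_sq_gaussianReal : ∫ x, x ^ 2 ∂gaussianReal 0 1 = 1 := by
  have h := variance_fun_id_gaussianReal (μ := 0) (v := 1)
  rw [variance_of_integral_eq_zero (by fun_prop) (by simp)] at h
  simpa using h

lemma variance_sq_gaussianReal : Var[fun x : ℝ => x ^ 2; gaussianReal 0 1] = 2 := by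
  rw [variance_eq_sub memLp_sq_gaussianReal]
  simp only [Pi.pow_apply, ← pow_mul]
  rw [integral_pow_four_gaussianReal, integral_sq_gaussianReal]
  norm_num

lemma mgf_sq_gaussianReal {t : ℝ} (ht : t < 1 / 2) :
    mgf (fun x : ℝ => x ^ 2) (gaussianReal 0 1) t = (√(1 - 2 * t))⁻¹ := by
  rw [mgf, integral_gaussianReal_eq_integral_smul one_ne_zero]
  have : ∀ x : ℝ, gaussianPDFReal 0 1 x • Real.exp (t * x ^ 2) =
      (√(2 * Real.pi))⁻¹ * Real.exp (-(1 / 2 - t) * x ^ 2) := fun x => by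
    rw [gaussianPDFReal, smul_eq_mul, mul_assoc, ← Real.exp_add]
    simp only [NNReal.coe_one, mul_one]
    congr 2
    ring
  simp only [this]
  rw [integral_const_mul, integral_gaussian, ← Real.sqrt_inv, ← Real.sqrt_inv,
    ← Real.sqrt_mul (by positivity)]
  congr 1
  have h1 : (1 / 2 - t) ≠ 0 := by linarith
  have h2 : (1 - 2 * t) ≠ 0 := by linarith
  field_simp

lemma integrable_exp_mul_sq_gaussianReal {t : ℝ} (ht : t < 1 / 2) :
    Integrable (fun x : ℝ => Real.exp (t * x ^ 2)) (gaussianReal 0 1) := by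
  -- The integral of a non-integrable function would be `0`.
  refine Integrable.of_integral_ne_zero ?_
  have h := mgf_sq_gaussianReal ht
  rw [mgf] at h
  rw [h]
  have : 0 < 1 - 2 * t := by linarith
  positivity

/-- Equivalently, `-u - u² ≤ log (1 - u)`, which controls the moment generating function of a
chi-square variable near `0`. -/
lemma exp_neg_sub_sq_le {u : ℝ} (hu : |u| ≤ 1 / 2) : Real.exp (-u - u ^ 2) ≤ 1 - u := by
  have h := abs_le.1 hu
  rcases le_total 0 u with h0 | h0
  · have h1 := Real.quadratic_le_exp_of_nonneg (x := u + u ^ 2) (by positivity)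
    have e : -u - u ^ 2 = -(u + u ^ 2) := by ring
    have h3 : 0 < 1 - u := by linarith
    rw [e, Real.exp_neg, inv_le_comm₀ (Real.exp_pos _) h3]
    refine le_trans ?_ h1
    rw [inv_le_iff_one_le_mul₀ h3]
    have h4 : 0 ≤ (1 + u) ^ 2 * (1 - u) - 2 * u := by nlinarith [mul_nonneg h0 h0, h.2]
    nlinarith [mul_nonneg (sq_nonneg u) h4]
  · have h1 : |-u - u ^ 2| ≤ 1 := abs_le.2 ⟨by nlinarith [h.1], by nlinarith [h.1]⟩
    have h2 := (abs_le.1 (Real.abs_exp_sub_one_sub_id_le h1)).2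
    nlinarith [mul_nonneg (sq_nonneg u) (by nlinarith [h.1] : 0 ≤ 1 - (1 + u) ^ 2)]

/-- The centred square of a standard normal variable is subexponential. -/
lemma mgf_sq_gaussianReal_le {t : ℝ} (ht : |t| ≤ 1 / 4) :
    mgf (fun x : ℝ => x ^ 2) (gaussianReal 0 1) t ≤ Real.exp (t + 2 * t ^ 2) := by
  have h := abs_le.1 ht
  rw [mgf_sq_gaussianReal (by linarith), inv_le_comm₀ (Real.sqrt_pos.2 (by linarith))
    (Real.exp_pos _), ← Real.exp_neg]
  refine Real.le_sqrt_of_sq_le ?_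
  rw [← Real.exp_nat_mul]
  refine le_trans (le_of_eq ?_) (exp_neg_sub_sq_le (u := 2 * t) (by rw [abs_mul]; norm_num; linarith))
  congr 1
  push_cast
  ring

lemma mgf_sumSq_le (k : ℕ) {t : ℝ} (ht : |t| ≤ 1 / 4) :
    mgf (sumSq k) gaussSeq t ≤ Real.exp (k * (t + 2 * t ^ 2)) := by
  have h := (iIndepFun_eval_gaussSeq.comp (fun _ x => x ^ 2) (by fun_prop)).mgf_sum (t := t)
    (fun i => by fun_prop) (Finset.range k)
  have e : (∑ i ∈ Finset.range k, (fun x : ℝ => x ^ 2) ∘ fun g : ℕ → ℝ => g i) = sumSq k := by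
    funext g; simp [sumSq]
  rw [e] at h
  have e2 : ∀ i, mgf ((fun x : ℝ => x ^ 2) ∘ fun g : ℕ → ℝ => g i) gaussSeq t =
      mgf (fun x : ℝ => x ^ 2) (gaussianReal 0 1) t := fun i => by
    rw [← map_eval_gaussSeq i]
    exact (mgf_map (measurable_pi_apply i).aemeasurable (by fun_prop)).symm
  rw [h, Finset.prod_congr rfl fun i _ => e2 i, Finset.prod_const, Finset.card_range,
    Real.exp_nat_mul]
  exact pow_le_pow_left₀ mgf_nonneg (mgf_sq_gaussianReal_le ht) k

lemma integrable_exp_mul_sumSq (k : ℕ) {t : ℝ} (ht : |t| ≤ 1 / 4) :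
    Integrable (fun g => Real.exp (t * sumSq k g)) gaussSeq := by
  have h := (iIndepFun_eval_gaussSeq.comp (fun _ x => x ^ 2) (by fun_prop)).integrable_exp_mul_sum
    (t := t) (fun i => by fun_prop) (s := Finset.range k) fun i _ => by
      have h1 := integrable_exp_mul_sq_gaussianReal (t := t) (by linarith [(abs_le.1 ht).2])
      rw [← map_eval_gaussSeq i] at h1
      exact h1.comp_measurable (by fun_prop)
  simpa [sumSq] using h

/-- Chernoff bound for a sum of `k` squares, in both tails. -/
lemma measureReal_sumSq_ge (k : ℕ) {n δ : ℝ} (hk : k ≤ n) (hδ0 : 0 < δ) (hδ1 : δ ≤ 1) :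
    gaussSeq.real {g | k + δ * n ≤ sumSq k g} ≤ Real.exp (-(δ ^ 2 / 8 * n)) := by
  have hn : 0 ≤ n := (Nat.cast_nonneg k).trans hk
  -- The choice `t = δ / 4` minimises the exponent `2 t² n - t δ n`.
  have ht : |δ / 4| ≤ 1 / 4 := by rw [abs_of_pos (by positivity)]; linarith
  refine (measure_ge_le_exp_mul_mgf _ (by positivity) (integrable_exp_mul_sumSq k ht)).trans ?_
  refine (mul_le_mul_of_nonneg_left (mgf_sumSq_le k ht) (Real.exp_pos _).le).trans ?_
  rw [← Real.exp_add]
  refine Real.exp_le_exp.2 ?_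
  nlinarith [mul_le_mul_of_nonneg_left hk (sq_nonneg δ)]

lemma measureReal_sumSq_le (k : ℕ) {n δ : ℝ} (hk : k ≤ n) (hδ0 : 0 < δ) (hδ1 : δ ≤ 1) :
    gaussSeq.real {g | sumSq k g ≤ k - δ * n} ≤ Real.exp (-(δ ^ 2 / 8 * n)) := by
  have hn : 0 ≤ n := (Nat.cast_nonneg k).trans hk
  have ht : |-(δ / 4)| ≤ 1 / 4 := by rw [abs_neg, abs_of_pos (by positivity)]; linarith
  refine (measure_le_le_exp_mul_mgf _ (by linarith) (integrable_exp_mul_sumSq k ht)).trans ?_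
  refine (mul_le_mul_of_nonneg_left (mgf_sumSq_le k ht) (Real.exp_pos _).le).trans ?_
  rw [← Real.exp_add]
  refine Real.exp_le_exp.2 ?_
  nlinarith [mul_le_mul_of_nonneg_left hk (sq_nonneg δ)]

lemma identDistrib_eval_gaussSeq (i : ℕ) :
    IdentDistrib (fun g : ℕ → ℝ => g i ^ 2) (fun x : ℝ => x ^ 2) gaussSeq (gaussianReal 0 1) :=
  IdentDistrib.comp (u := fun x : ℝ => x ^ 2)
    ⟨(measurable_pi_apply i).aemeasurable, aemeasurable_id',
      by rw [map_eval_gaussSeq, Measure.map_id']⟩ (by fun_prop)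

lemma memLp_sumSq (k : ℕ) : MemLp (sumSq k) 2 gaussSeq := by
  unfold sumSq
  exact memLp_finsetSum _ fun i _ =>
    ((identDistrib_eval_gaussSeq i).memLp_iff).2 memLp_sq_gaussianReal

lemma integral_sumSq (k : ℕ) : ∫ g, sumSq k g ∂gaussSeq = k := by
  unfold sumSq
  rw [integral_finsetSum _ fun i _ =>
    (((identDistrib_eval_gaussSeq i).memLp_iff).2 memLp_sq_gaussianReal).integrable one_le_two]
  simp [(identDistrib_eval_gaussSeq _).integral_eq, integral_sq_gaussianReal]

lemma variance_sumSq (k : ℕ) : Var[sumSq k; gaussSeq] = 2 * k := by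
  have hind := iIndepFun_eval_gaussSeq.comp (fun _ x => x ^ 2) (by fun_prop)
  have h := IndepFun.variance_sum (s := Finset.range k)
    (X := fun i (g : ℕ → ℝ) => g i ^ 2) (μ := gaussSeq)
    (fun i _ => ((identDistrib_eval_gaussSeq i).memLp_iff).2 memLp_sq_gaussianReal)
    fun i _ j _ hij => hind.indepFun hij
  have e : (∑ i ∈ Finset.range k, fun g : ℕ → ℝ => g i ^ 2) = sumSq k := by
    funext g; simp [sumSq]
  rw [e] at h
  rw [h]
  simp [(identDistrib_eval_gaussSeq _).variance_eq, variance_sq_gaussianReal, mul_comm]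

/-- The mean absolute deviation is at most the standard deviation. -/
lemma integral_abs_sumSq_sub_le (k : ℕ) : ∫ g, |sumSq k g - k| ∂gaussSeq ≤ √(2 * k) := by
  have hm : MemLp (fun g => sumSq k g - k) 2 gaussSeq := (memLp_sumSq k).sub (memLp_const _)
  have h := variance_nonneg (fun g => |sumSq k g - k|) gaussSeq
  rw [variance_eq_sub (X := fun g => |sumSq k g - k|) hm.abs] at h
  have h2 : ∫ g, (sumSq k g - k) ^ 2 ∂gaussSeq = 2 * k := by
    rw [← variance_sumSq k, variance_eq_integral (by fun_prop), integral_sumSq]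
  simp only [Pi.pow_apply, sq_abs] at h
  rw [h2] at h
  exact Real.le_sqrt_of_sq_le (by linarith)

/-- The central limit theorem for sums of squares of standard normal variables. -/
lemma tendstoInDistribution_sumSq {Ω' : Type*} [MeasurableSpace Ω'] {Q : Measure Ω'}
    [IsProbabilityMeasure Q] {Y : Ω' → ℝ} (hY : HasLaw Y (gaussianReal 0 2) Q) :
    TendstoInDistribution (fun (k : ℕ) g => (√k)⁻¹ * (sumSq k g - k)) atTop Y
      (fun _ => gaussSeq) Q := by
  have hv : Var[fun g : ℕ → ℝ => g 0 ^ 2; gaussSeq] = 2 := by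
    rw [(identDistrib_eval_gaussSeq 0).variance_eq, variance_sq_gaussianReal]
  have h := tendstoInDistribution_inv_sqrt_mul_sum_sub (P := gaussSeq) (P' := Q)
    (X := fun i (g : ℕ → ℝ) => g i ^ 2) (Y := Y) (by
      rw [hv]; convert hY using 2; norm_num)
    (((identDistrib_eval_gaussSeq 0).memLp_iff).2 memLp_sq_gaussianReal)
    (iIndepFun_eval_gaussSeq.comp (fun _ x => x ^ 2) (by fun_prop))
    fun i => (identDistrib_eval_gaussSeq i).trans (identDistrib_eval_gaussSeq 0).symm
  simpa [sumSq, (identDistrib_eval_gaussSeq 0).integral_eq, integral_sq_gaussianReal] using h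

/-! ### Fluctuations and deviations of rescaled chi variables -/

section

variable {Ω : ℕ → Type*} {mΩ : ∀ n, MeasurableSpace (Ω n)} {P : ∀ n, Measure (Ω n)}
  [∀ n, IsProbabilityMeasure (P n)] {Ω' : Type*} {mΩ' : MeasurableSpace Ω'} {Q : Measure Ω'}
  [IsProbabilityMeasure Q]

/-- If `k → ∞` and `m - k` stays bounded, then `χ_k - √m` converges in distribution to a centred
normal variable with variance `1 / 2`. -/
theorem tendstoInDistribution_chi {X : ∀ n, Ω n → ℝ} (hXm : ∀ n, AEMeasurable (X n) (P n))
    {k m : ℕ → ℕ} (hk : Tendsto k atTop atTop) {D : ℕ}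
    (hkm : ∀ᶠ n in atTop, k n ≤ m n ∧ m n ≤ k n + D)
    (hX : ∀ᶠ n in atTop, HasLaw (X n) ((chiMeasure (k n)).map fun x => x - √(m n)) (P n))
    {Y : Ω' → ℝ} (hY : HasLaw Y (gaussianReal 0 (1 / 2)) Q) :
    TendstoInDistribution X atTop Y P Q := by
  have hY2 : HasLaw (fun ω => 2 * Y ω) (gaussianReal 0 2) Q := by
    convert gaussianReal_const_mul hY 2 using 2
    · simp
    · ext; norm_num
  have hS := tendstoInDistribution_sumSq hY2
  have hSk : TendstoInDistribution (fun n g => (√(k n : ℝ))⁻¹ * (sumSq (k n) g - k n)) atTop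
      (fun ω => 2 * Y ω) (fun _ => gaussSeq) Q :=
    ⟨fun n => hS.forall_aemeasurable _, hS.aemeasurable_limit, hS.tendsto.comp hk⟩
  have hsqrt : Tendsto (fun n => √(k n : ℝ)) atTop atTop :=
    Real.tendsto_sqrt_atTop.comp (tendsto_natCast_atTop_atTop.comp hk)
  have hε : Tendsto (fun n => (√(k n : ℝ))⁻¹) atTop (𝓝 0) := tendsto_inv_atTop_zero.comp hsqrt
  have hη : Tendsto (fun n => √(k n : ℝ) - √(m n)) atTop (𝓝 0) := by
    have h0 : Tendsto (fun n => -(D * (√(k n : ℝ))⁻¹)) atTop (𝓝 0) := by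
      simpa using (hε.const_mul (D : ℝ)).neg
    refine tendsto_of_tendsto_of_tendsto_of_le_of_le' h0 tendsto_const_nhds ?_ ?_
    · filter_upwards [hkm, hk.eventually_ge_atTop 1] with n hn hn1
      have hpos : 0 < √(k n : ℝ) := Real.sqrt_pos.2 (by exact_mod_cast hn1)
      have h1 : √(m n : ℝ) ≤ √(k n) + D * (√(k n : ℝ))⁻¹ := by
        refine Real.sqrt_le_iff.2 ⟨by positivity, ?_⟩
        have h2 : (m n : ℝ) ≤ k n + D := by exact_mod_cast hn.2
        have h3 : (√(k n) + D * (√(k n : ℝ))⁻¹) ^ 2 =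
            k n + 2 * D + (D * (√(k n : ℝ))⁻¹) ^ 2 := by
          rw [add_sq, Real.sq_sqrt (Nat.cast_nonneg _)]
          field_simp
        rw [h3]
        have : (0 : ℝ) ≤ D := Nat.cast_nonneg _
        nlinarith [sq_nonneg (D * (√(k n : ℝ))⁻¹)]
      linarith
    · filter_upwards [hkm] with n hn
      have : √(k n : ℝ) ≤ √(m n) := Real.sqrt_le_sqrt (by exact_mod_cast hn.1)
      linarith
  -- With `x = (S - k) / √k` and `ε = 1 / √k`, where `S` is a sum of `k` squares, one has
  -- `√S - √k = x / (1 + √(1 + ε x))`, a continuous function of `(x, ε)` also at `ε = 0`.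
  have key := (tendstoInDistribution_prodMk_const hSk (hε.prodMk_nhds hη)).continuous_comp
    (g := fun p : ℝ × ℝ × ℝ => p.1 / (1 + √(1 + p.2.1 * p.1)) + p.2.2) (by
      have : ∀ p : ℝ × ℝ × ℝ, 1 + √(1 + p.2.1 * p.1) ≠ 0 := fun p => by positivity
      fun_prop (disch := assumption))
  refine ⟨hXm, hY.aemeasurable, ?_⟩
  have e : (fun p : ℝ × ℝ × ℝ => p.1 / (1 + √(1 + p.2.1 * p.1)) + p.2.2) ∘
      (fun ω => (2 * Y ω, (0 : ℝ), (0 : ℝ))) = Y := by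
    funext ω
    simp only [Function.comp, zero_mul, add_zero, Real.sqrt_one]
    ring
  have ht := key.tendsto
  simp only [e] at ht
  refine ht.congr' ?_
  filter_upwards [hX, hk.eventually_ge_atTop 1] with n hn hn1
  refine Subtype.ext ?_
  simp only
  rw [hn.map_eq, chiMeasure_eq_map, Measure.map_map (by fun_prop) (by fun_prop)]
  congr 1
  funext g
  have hk0 : (0 : ℝ) < k n := by exact_mod_cast hn1
  have hpos : 0 < √(k n : ℝ) := Real.sqrt_pos.2 hk0
  have h1 : 1 + (√(k n : ℝ))⁻¹ * ((√(k n : ℝ))⁻¹ * (sumSq (k n) g - k n)) =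
      sumSq (k n) g / k n := by
    rw [← mul_assoc, ← mul_inv, Real.mul_self_sqrt hk0.le]
    field_simp
    ring
  have h2 : sumSq (k n) g = √(sumSq (k n) g) ^ 2 := (Real.sq_sqrt (sumSq_nonneg _ _)).symm
  have h3 : (k n : ℝ) = √(k n : ℝ) ^ 2 := (Real.sq_sqrt hk0.le).symm
  simp only [Function.comp]
  rw [h1, Real.sqrt_div (sumSq_nonneg _ _)]
  have h4 : √(k n : ℝ) + √(sumSq (k n) g) ≠ 0 := by positivity
  have h5 : (√(k n : ℝ))⁻¹ * (sumSq (k n) g - k n) / (1 + √(sumSq (k n) g) / √(k n)) =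
      √(sumSq (k n) g) - √(k n) := by
    field_simp
    nlinarith
  rw [h5]
  ring

end

section

variable {Ω : Type*} [MeasurableSpace Ω] {P : Measure Ω}
  {β M k : ℕ} {X : Ω → ℝ}

lemma hasLaw_sqrt_mul_sub (hX : HasLaw X (scaledChiMeasure β M k) P) (hβM : 0 < (β : ℝ) * M)
    (c : ℝ) :
    HasLaw (fun ω => √((β : ℝ) * M) * X ω - c) ((chiMeasure k).map fun x => x - c) P where
  aemeasurable := (hX.aemeasurable.const_mul _).sub_const _
  map_eq := by
    have h : (fun ω => √((β : ℝ) * M) * X ω - c) =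
        (fun x => √((β : ℝ) * M) * x - c) ∘ X := rfl
    rw [h, ← AEMeasurable.map_map_of_aemeasurable (by fun_prop) hX.aemeasurable, hX.map_eq,
      scaledChiMeasure, Measure.map_map (by fun_prop) (by fun_prop)]
    congr 1
    funext x
    have : √((β : ℝ) * M) ≠ 0 := (Real.sqrt_pos.2 hβM).ne'
    simp only [Function.comp]
    field_simp

lemma identDistrib_sq (hX : HasLaw X (scaledChiMeasure β M k) P) :
    IdentDistrib (fun ω => X ω ^ 2) (fun g => sumSq k g / ((β : ℝ) * M)) P gaussSeq := by
  have h : IdentDistrib X (fun g => √(sumSq k g) / √((β : ℝ) * M)) P gaussSeq :=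
    ⟨hX.aemeasurable, by fun_prop, by
      rw [hX.map_eq, scaledChiMeasure, chiMeasure_eq_map, Measure.map_map (by fun_prop)
        (by fun_prop)]; rfl⟩
  have h2 := h.comp (u := fun x => x ^ 2) (by fun_prop)
  have e : (fun x : ℝ => x ^ 2) ∘ (fun g => √(sumSq k g) / √((β : ℝ) * M)) =
      fun g => sumSq k g / ((β : ℝ) * M) := by
    funext g
    simp only [Function.comp, div_pow]
    rw [Real.sq_sqrt (sumSq_nonneg _ _), Real.sq_sqrt (by positivity)]
  rw [e] at h2
  exact h2

/-- Chernoff bound for the upper tail of the square of a rescaled chi variable. -/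
lemma measureReal_sq_ge (hX : HasLaw X (scaledChiMeasure β M k) P) (hβM : 0 < (β : ℝ) * M)
    (hk : (k : ℝ) ≤ β * M) {δ : ℝ} (hδ0 : 0 < δ) (hδ1 : δ ≤ 1) :
    P.real {ω | (k : ℝ) / (β * M) + δ ≤ X ω ^ 2} ≤ Real.exp (-(δ ^ 2 / 8 * (β * M))) := by
  refine le_trans (le_of_eq ?_) (measureReal_sumSq_ge k hk hδ0 hδ1)
  have h := (identDistrib_sq hX).measure_mem_eq
    (measurableSet_Ici (a := (k : ℝ) / (β * M) + δ))
  rw [measureReal_def, measureReal_def]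
  congr 1
  refine Eq.trans h ?_
  congr 1
  ext g
  have : (k : ℝ) / (β * M) + δ = (k + δ * (β * M)) / (β * M) := by
    rw [add_div, mul_div_cancel_right₀ _ hβM.ne']
  simp only [Set.mem_preimage, Set.mem_Ici, Set.mem_ofPred_eq]
  rw [this, div_le_div_iff_of_pos_right hβM]

/-- Chernoff bound for the lower tail of the square of a rescaled chi variable. -/
lemma measureReal_sq_le (hX : HasLaw X (scaledChiMeasure β M k) P) (hβM : 0 < (β : ℝ) * M)
    (hk : (k : ℝ) ≤ β * M) {δ : ℝ} (hδ0 : 0 < δ) (hδ1 : δ ≤ 1) :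
    P.real {ω | X ω ^ 2 ≤ (k : ℝ) / (β * M) - δ} ≤ Real.exp (-(δ ^ 2 / 8 * (β * M))) := by
  refine le_trans (le_of_eq ?_) (measureReal_sumSq_le k hk hδ0 hδ1)
  have h := (identDistrib_sq hX).measure_mem_eq
    (measurableSet_Iic (a := (k : ℝ) / (β * M) - δ))
  rw [measureReal_def, measureReal_def]
  congr 1
  refine Eq.trans h ?_
  congr 1
  ext g
  have : (k : ℝ) / (β * M) - δ = (k - δ * (β * M)) / (β * M) := by
    rw [sub_div, mul_div_cancel_right₀ _ hβM.ne']
  simp only [Set.mem_preimage, Set.mem_Iic, Set.mem_ofPred_eq]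
  rw [this, div_le_div_iff_of_pos_right hβM]

lemma identDistrib_abs_sq_sub (hX : HasLaw X (scaledChiMeasure β M k) P)
    (hβM : 0 < (β : ℝ) * M) :
    IdentDistrib (fun ω => √((β : ℝ) * M) * |X ω ^ 2 - (k : ℝ) / (β * M)|)
      (fun g => |sumSq k g - k| / √((β : ℝ) * M)) P gaussSeq := by
  have h := (identDistrib_sq hX).comp
    (u := fun x : ℝ => √((β : ℝ) * M) * |x - (k : ℝ) / (β * M)|) (by fun_prop)
  have e : (fun x : ℝ => √((β : ℝ) * M) * |x - (k : ℝ) / (β * M)|) ∘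
      (fun g => sumSq k g / ((β : ℝ) * M)) = fun g => |sumSq k g - k| / √((β : ℝ) * M) := by
    funext g
    have h1 : √((β : ℝ) * M) * √((β : ℝ) * M) = β * M := Real.mul_self_sqrt hβM.le
    have h2 : √((β : ℝ) * M) ≠ 0 := (Real.sqrt_pos.2 hβM).ne'
    simp only [Function.comp_apply]
    rw [← sub_div, abs_div, abs_of_pos hβM, eq_div_iff h2, mul_comm, ← mul_assoc, h1,
      mul_div_cancel₀ _ hβM.ne']
  rw [e] at h
  exact h

lemma integrable_abs_sq_sub (hX : HasLaw X (scaledChiMeasure β M k) P)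
    (hβM : 0 < (β : ℝ) * M) :
    Integrable (fun ω => √((β : ℝ) * M) * |X ω ^ 2 - (k : ℝ) / (β * M)|) P :=
  (identDistrib_abs_sq_sub hX hβM).integrable_iff.2
    ((((memLp_sumSq k).integrable one_le_two).sub (integrable_const _)).abs.div_const _)

lemma integral_abs_sq_sub_le (hX : HasLaw X (scaledChiMeasure β M k) P)
    (hβM : 0 < (β : ℝ) * M) (hk : (k : ℝ) ≤ β * M) :
    ∫ ω, √((β : ℝ) * M) * |X ω ^ 2 - (k : ℝ) / (β * M)| ∂P ≤ √2 := by
  rw [(identDistrib_abs_sq_sub hX hβM).integral_eq, integral_div,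
    div_le_iff₀ (Real.sqrt_pos.2 hβM), ← Real.sqrt_mul (by norm_num)]
  exact (integral_abs_sumSq_sub_le k).trans (Real.sqrt_le_sqrt (by linarith))

end

/-! ### The corner entry of the inverse of a bidiagonal Gram matrix -/

/-- The matrix `H` is lower bidiagonal: only the diagonal and subdiagonal entries may differ from
`0`. -/
def IsLowerBidiagonal {N : ℕ} (H : Matrix (Fin N) (Fin N) ℝ) : Prop :=
  ∀ i j : Fin N, i ≠ j → (i : ℕ) ≠ j + 1 → H i j = 0

/-- The squared ratio `β_l² / α_{l+1}²`. -/
noncomputable def ratio (a b : ℕ → ℝ) (l : ℕ) : ℝ := b l ^ 2 / a (l + 1) ^ 2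

/-- The entries of the solution `x` of `H x = f₁` for the lower bidiagonal matrix with diagonal `a`
and subdiagonal `b`. -/
noncomputable def firstColumn (a b : ℕ → ℝ) : ℕ → ℝ
  | 0 => (a 0)⁻¹
  | j + 1 => -(b j * firstColumn a b j / a (j + 1))

lemma firstColumn_sq (a b : ℕ → ℝ) (j : ℕ) :
    firstColumn a b j ^ 2 = (a 0 ^ 2)⁻¹ * ∏ i ∈ Finset.range j, ratio a b i := by
  induction j with
  | zero => simp [firstColumn]
  | succ j ih =>
    rw [firstColumn, Finset.prod_range_succ, ← mul_assoc, ← ih, ratio]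
    ring

lemma mulVec_firstColumn {N : ℕ} {H : Matrix (Fin N) (Fin N) ℝ} (hH : IsLowerBidiagonal H)
    (ha : ∀ j < N, alphaEntry H j ≠ 0) :
    H.mulVec (fun i : Fin N => firstColumn (alphaEntry H) (betaEntry H) i) = firstBasis N := by
  funext i
  have hai : alphaEntry H i = H i i := by simp [alphaEntry]
  have ha0 : H i i ≠ 0 := hai ▸ ha i i.2
  obtain ⟨i, hi⟩ := i
  rw [Matrix.mulVec, dotProduct]
  cases i with
  | zero =>
    rw [Finset.sum_eq_single ⟨0, hi⟩]
    · simp only [firstColumn, firstBasis, if_true]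
      rw [hai]
      exact mul_inv_cancel₀ ha0
    · intro j _ hj
      rw [hH _ _ hj.symm (by simp), zero_mul]
    · simp
  | succ i =>
    have hi' : i < N := Nat.lt_of_succ_lt hi
    rw [Finset.sum_eq_add (⟨i, hi'⟩ : Fin N) ⟨i + 1, hi⟩ (by simp)]
    · have hb : betaEntry H i = H ⟨i + 1, hi⟩ ⟨i, hi'⟩ := by simp [betaEntry, hi]
      simp only [firstColumn, firstBasis]
      simp only at hai
      rw [hai, hb]
      field_simp
      simp
    · intro j _ hj
      rw [hH _ _ hj.2.symm, zero_mul]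
      intro h
      exact hj.1 (Fin.ext (by simpa using h.symm))
    · simp
    · simp

/-- The corner entry of `(H Hᵀ)⁻¹` is the squared norm of the solution of `H x = f₁`. -/
theorem invCorner_eq {N : ℕ} {H : Matrix (Fin N) (Fin N) ℝ} (hH : IsLowerBidiagonal H)
    (ha : ∀ j < N, alphaEntry H j ≠ 0) :
    invCorner H = (alphaEntry H 0 ^ 2)⁻¹ *
      ∑ j ∈ Finset.range N, ∏ i ∈ Finset.range j, ratio (alphaEntry H) (betaEntry H) i := by
  have hdet : IsUnit H.det := by
    rw [Matrix.det_of_isLowerTriangular H (fun i j hij => hH i j (by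
      rintro rfl; exact lt_irrefl _ hij) (by
        have : i < j := hij
        have := Fin.lt_def.1 this
        omega)), isUnit_iff_ne_zero, Finset.prod_ne_zero_iff]
    intro i _
    have := ha i i.2
    simpa [alphaEntry] using this
  have hx : H⁻¹.mulVec (firstBasis N) =
      fun i : Fin N => firstColumn (alphaEntry H) (betaEntry H) i := by
    rw [← mulVec_firstColumn hH ha, Matrix.mulVec_mulVec, Matrix.nonsing_inv_mul _ hdet,
      Matrix.one_mulVec]
  rw [invCorner, Matrix.mul_inv_rev, ← Matrix.mulVec_mulVec, Matrix.dotProduct_mulVec,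
    ← Matrix.transpose_nonsing_inv, Matrix.vecMul_transpose, hx, dotProduct, Finset.mul_sum,
    Finset.sum_range]
  exact Finset.sum_congr rfl fun i _ => by rw [← sq, firstColumn_sq]

/-- A sum of partial products is compared with the geometric series `c = 1 / (1 - δ)`. -/
lemma sum_prod_sub (r : ℕ → ℝ) {δ c : ℝ} (hc : c * (1 - δ) = 1) (n : ℕ) :
    ∑ j ∈ Finset.range (n + 1), ∏ i ∈ Finset.range j, r i - c =
      c * ∑ l ∈ Finset.range n, (∏ i ∈ Finset.range l, r i) * (r l - δ) +
        (∏ i ∈ Finset.range n, r i) * (1 - c) := by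
  induction n with
  | zero => simp
  | succ n ih =>
    rw [Finset.sum_range_succ (fun j => ∏ i ∈ Finset.range j, r i) (n + 1),
      Finset.sum_range_succ (fun l => (∏ i ∈ Finset.range l, r i) * (r l - δ)) n,
      Finset.prod_range_succ]
    linear_combination ih - (∏ i ∈ Finset.range n, r i) * hc

/-- The inverse of `x`, cut off at `1 / κ` to become continuous. -/
noncomputable def cutInv (κ x : ℝ) : ℝ := (max x κ)⁻¹

lemma cutInv_of_le {κ x : ℝ} (h : κ ≤ x) : cutInv κ x = x⁻¹ := by rw [cutInv, max_eq_left h]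

lemma continuous_cutInv {κ : ℝ} (hκ : 0 < κ) : Continuous (cutInv κ) :=
  (continuous_id.max continuous_const).inv₀ fun _ => (lt_max_of_lt_right hκ).ne'

/-- The first `L` terms of the fluctuation of the corner entry, as a function of the fluctuations
`v = √(βM) (α₀ - 1, β₀ - σ, α₁ - 1, β₁ - σ, …)` of the matrix entries, of `ε = 1 / √(βM)`,
`σ = √𝔡` and `c = 1 / (1 - 𝔡)`. The inverses are cut off at `1 / κ`, which makes the function
continuous, also at `ε = 0`. -/
noncomputable def truncCorner (κ : ℝ) (L : ℕ) (v : ℕ → ℝ) (ε σ c : ℝ) : ℝ :=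
  c * cutInv κ ((1 + ε * v 0) ^ 2) * (-(v 0 * (2 + ε * v 0)) +
    ∑ l ∈ Finset.range L,
      (∏ i ∈ Finset.range l,
        (σ + ε * v (2 * i + 1)) ^ 2 * cutInv κ ((1 + ε * v (2 * i + 2)) ^ 2)) *
      ((v (2 * l + 1) * (2 * σ + ε * v (2 * l + 1)) -
        σ ^ 2 * (v (2 * l + 2) * (2 + ε * v (2 * l + 2)))) *
        cutInv κ ((1 + ε * v (2 * l + 2)) ^ 2)))

lemma continuous_truncCorner {κ : ℝ} (hκ : 0 < κ) (L : ℕ) :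
    Continuous fun p : (ℕ → ℝ) × ℝ × ℝ × ℝ => truncCorner κ L p.1 p.2.1 p.2.2.1 p.2.2.2 := by
  have h := continuous_cutInv hκ
  unfold truncCorner
  fun_prop

/-- In the limit `ε = 0` the truncated fluctuation is linear in `v`. -/
lemma truncCorner_zero {κ : ℝ} (hκ : κ ≤ 1) (L : ℕ) (v : ℕ → ℝ) (σ c : ℝ) :
    truncCorner κ L v 0 σ c = c * (-(2 * v 0) +
      ∑ l ∈ Finset.range L, (σ ^ 2) ^ l * (2 * σ * v (2 * l + 1) - 2 * σ ^ 2 * v (2 * l + 2))) := by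
  have h1 : cutInv κ 1 = 1 := by rw [cutInv_of_le hκ, inv_one]
  simp only [truncCorner, zero_mul, add_zero, one_pow, h1, mul_one, Finset.prod_const,
    Finset.card_range]
  congr 2
  · ring
  · exact Finset.sum_congr rfl fun l _ => by ring

/-- The exact difference between the fluctuation of the corner entry and its truncation, in terms of
the entries `a`, `b` of the matrix, as long as the cut-off of the inverses is not active. -/
lemma corner_sub_truncCorner {κ s σ c : ℝ} (hκ : 0 < κ) (hs : 0 < s) (hc : c * (1 - σ ^ 2) = 1)
    {a b v : ℕ → ℝ} {L n : ℕ} (hL : L ≤ n) (ha : ∀ j ≤ L, κ ≤ a j ^ 2)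
    (hva : ∀ j ≤ L, v (2 * j) = s * (a j - 1)) (hvb : ∀ j < L, v (2 * j + 1) = s * (b j - σ)) :
    s * ((a 0 ^ 2)⁻¹ * ∑ j ∈ Finset.range (n + 1), ∏ i ∈ Finset.range j, ratio a b i - c) -
      truncCorner κ L v s⁻¹ σ c =
    (a 0 ^ 2)⁻¹ * (c * ∑ l ∈ Finset.Ico L n,
      (∏ i ∈ Finset.range l, ratio a b i) * (s * (ratio a b l - σ ^ 2)) +
        s * (∏ i ∈ Finset.range n, ratio a b i) * (1 - c)) := by
  have hA : ∀ j ≤ L, 1 + s⁻¹ * v (2 * j) = a j := fun j hj => by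
    rw [hva j hj]; field_simp; ring
  have hB : ∀ j < L, σ + s⁻¹ * v (2 * j + 1) = b j := fun j hj => by
    rw [hvb j hj]; field_simp; ring
  have ha0 : ∀ j ≤ L, a j ^ 2 ≠ 0 := fun j hj => (hκ.trans_le (ha j hj)).ne'
  have hinv : ∀ j ≤ L, cutInv κ ((1 + s⁻¹ * v (2 * j)) ^ 2) = (a j ^ 2)⁻¹ := fun j hj => by
    rw [hA j hj, cutInv_of_le (ha j hj)]
  have htr : truncCorner κ L v s⁻¹ σ c = c * (a 0 ^ 2)⁻¹ * (-(s * (a 0 ^ 2 - 1)) +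
      ∑ l ∈ Finset.range L,
        (∏ i ∈ Finset.range l, ratio a b i) * (s * (ratio a b l - σ ^ 2))) := by
    have h0 := hinv 0 (Nat.zero_le _)
    simp only [mul_zero] at h0
    rw [truncCorner, h0]
    congr 2
    · rw [show v 0 = s * (a 0 - 1) from hva 0 (Nat.zero_le _)]
      field_simp
      ring
    · refine Finset.sum_congr rfl fun l hl => ?_
      have hl' := Finset.mem_range.1 hl
      congr 1
      · refine Finset.prod_congr rfl fun i hi => ?_
        have hi' : i < L := (Finset.mem_range.1 hi).trans hl'
        rw [hB i hi', show 2 * i + 2 = 2 * (i + 1) by ring, hinv (i + 1) hi', ratio, div_eq_mul_inv]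
      · rw [show 2 * l + 2 = 2 * (l + 1) by ring, hinv (l + 1) hl', hvb l hl', hva (l + 1) hl',
          ratio]
        have := (pow_ne_zero_iff two_ne_zero).1 (ha0 (l + 1) hl')
        field_simp
        ring
  have hsplit := Finset.sum_range_add_sum_Ico
    (fun l => (∏ i ∈ Finset.range l, ratio a b i) * (s * (ratio a b l - σ ^ 2))) hL
  have hs' : ∑ l ∈ Finset.range n, (∏ i ∈ Finset.range l, ratio a b i) *
      (s * (ratio a b l - σ ^ 2)) = s * ∑ l ∈ Finset.range n, (∏ i ∈ Finset.range l, ratio a b i) *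
      (ratio a b l - σ ^ 2) := by
    rw [Finset.mul_sum]
    exact Finset.sum_congr rfl fun l _ => by ring
  have hmain := sum_prod_sub (ratio a b) hc n
  have h00 : (a 0 ^ 2)⁻¹ * a 0 ^ 2 = 1 := inv_mul_cancel₀ (ha0 0 (Nat.zero_le _))
  rw [htr]
  linear_combination s * (a 0 ^ 2)⁻¹ * hmain - c * (a 0 ^ 2)⁻¹ * hs' -
    c * (a 0 ^ 2)⁻¹ * hsplit + s * c * h00

/-- If all ratios are at most `ρ < 1`, the error of the truncation is a geometrically weighted sum
of the fluctuations of the single ratios. -/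
lemma abs_corner_sub_truncCorner_le {κ s σ c ρ C : ℝ} (hκ : 0 < κ) (hs : 0 < s)
    (hc : c * (1 - σ ^ 2) = 1) (hC : |c| ≤ C) (hC' : |1 - c| ≤ C)
    {a b v : ℕ → ℝ} {L n : ℕ} (hL : L ≤ n) (ha : ∀ j ≤ n, κ ≤ a j ^ 2)
    (hr : ∀ l < n, ratio a b l ≤ ρ)
    (hva : ∀ j ≤ L, v (2 * j) = s * (a j - 1)) (hvb : ∀ j < L, v (2 * j + 1) = s * (b j - σ)) :
    |s * ((a 0 ^ 2)⁻¹ * ∑ j ∈ Finset.range (n + 1), ∏ i ∈ Finset.range j, ratio a b i - c) -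
      truncCorner κ L v s⁻¹ σ c| ≤
    κ⁻¹ * C * (∑ l ∈ Finset.Ico L n, ρ ^ l * (κ⁻¹ * (s * |b l ^ 2 - σ ^ 2 * a (l + 1) ^ 2|)) +
      s * ρ ^ n) := by
  rw [corner_sub_truncCorner hκ hs hc hL (fun j hj => ha j (hj.trans hL)) hva hvb]
  have hC0 : 0 ≤ C := (abs_nonneg _).trans hC
  have hr0 : ∀ l, 0 ≤ ratio a b l := fun l => by unfold ratio; positivity
  have hprod0 : ∀ l, 0 ≤ ∏ i ∈ Finset.range l, ratio a b i :=
    fun l => Finset.prod_nonneg fun i _ => hr0 i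
  have hprod : ∀ l ≤ n, ∏ i ∈ Finset.range l, ratio a b i ≤ ρ ^ l := fun l hl => by
    refine (Finset.prod_le_prod (fun i _ => hr0 i) fun i hi =>
      hr i ((Finset.mem_range.1 hi).trans_le hl)).trans (le_of_eq ?_)
    simp
  have hinv : ∀ j ≤ n, (a j ^ 2)⁻¹ ≤ κ⁻¹ := fun j hj => inv_anti₀ hκ (ha j hj)
  rw [abs_mul, abs_of_nonneg (by positivity : 0 ≤ (a 0 ^ 2)⁻¹), mul_assoc κ⁻¹]
  refine mul_le_mul (hinv 0 (Nat.zero_le _)) ?_ (abs_nonneg _) (by positivity)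
  refine (abs_add_le _ _).trans ?_
  rw [mul_add]
  refine add_le_add ?_ ?_
  · rw [abs_mul]
    refine mul_le_mul hC ?_ (abs_nonneg _) hC0
    refine (Finset.abs_sum_le_sum_abs _ _).trans (Finset.sum_le_sum fun l hl => ?_)
    have hl' := (Finset.mem_Ico.1 hl).2
    rw [abs_mul, abs_of_nonneg (hprod0 l)]
    refine mul_le_mul (hprod l hl'.le) ?_ (abs_nonneg _) ((hprod0 l).trans (hprod l hl'.le))
    have h0 : a (l + 1) ≠ 0 :=
      (pow_ne_zero_iff two_ne_zero).1 (hκ.trans_le (ha (l + 1) hl')).ne'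
    have e : s * (ratio a b l - σ ^ 2) =
        (a (l + 1) ^ 2)⁻¹ * (s * (b l ^ 2 - σ ^ 2 * a (l + 1) ^ 2)) := by
      rw [ratio]; field_simp
    rw [e, abs_mul, abs_mul, abs_of_pos hs, abs_of_nonneg (by positivity : 0 ≤ (a (l + 1) ^ 2)⁻¹)]
    exact mul_le_mul_of_nonneg_right (hinv (l + 1) hl') (by positivity)
  · rw [abs_mul, abs_mul, abs_of_pos hs, abs_of_nonneg (hprod0 n), mul_comm]
    exact mul_le_mul hC' (mul_le_mul_of_nonneg_left (hprod n le_rfl) hs.le)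
      (mul_nonneg hs.le (hprod0 n)) hC0

/-! ### The limiting series and the matrix entries -/

section Limit

variable {Ω' : Type*} [MeasurableSpace Ω'] {Q : Measure Ω'} {Z : ℕ → Ω' → ℝ} {d : ℝ}

lemma eLpNorm_two_gaussian {Y : Ω' → ℝ} (hY : HasLaw Y (gaussianReal 0 1) Q) :
    eLpNorm Y 2 Q = 1 := by
  have h : eLpNorm Y 2 Q = eLpNorm id 2 (gaussianReal 0 1) := by
    rw [← hY.map_eq, eLpNorm_map_measure (by fun_prop) hY.aemeasurable]
    rfl
  have h2 : MemLp id 2 (gaussianReal 0 1) := memLp_id_gaussianReal' 2 (by simp)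
  rw [h, h2.eLpNorm_eq_integral_rpow_norm (by simp) (by simp)]
  simp [integral_sq_gaussianReal]

/-- The series defining the limit converges absolutely almost surely, because the `L²` norms of its
terms are summable. -/
theorem ae_summable_limitTerm (hd0 : 0 < d) (hd1 : d < 1)
    (hZ : ∀ j, 1 ≤ j → HasLaw (Z j) (gaussianReal 0 1) Q) :
    ∀ᵐ ω ∂Q, Summable (fun k : ℕ => limitTerm d (fun j => Z j ω) (k + 1)) := by
  have hm : ∀ j, 1 ≤ j → AEStronglyMeasurable (Z j) Q :=
    fun j hj => (hZ j hj).aemeasurable.aestronglyMeasurable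
  have hf : ∀ k, (fun ω => limitTerm d (fun j => Z j ω) (k + 1)) =
      (d ^ (k + 1) / (1 - d)) • ((√d)⁻¹ • Z (2 * (k + 1)) - Z (2 * (k + 1) + 1)) := fun k => by
    funext ω
    simp only [limitTerm, Pi.smul_apply, Pi.sub_apply, smul_eq_mul]
    ring
  have hle : ∀ k : ℕ, eLpNorm (fun ω => limitTerm d (fun j => Z j ω) (k + 1)) 2 Q ≤
      ENNReal.ofReal (d ^ k * (d / (1 - d))) * (‖(√d)⁻¹‖ₑ + 1) := fun k => by
    have h1d : 0 < 1 - d := by linarith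
    rw [hf, eLpNorm_const_smul, Real.enorm_of_nonneg (by positivity), pow_succ, mul_div_assoc]
    gcongr
    refine (eLpNorm_sub_le ((hm _ (by omega)).const_smul _) (hm _ (by omega)) one_le_two).trans ?_
    rw [eLpNorm_const_smul, eLpNorm_two_gaussian (hZ _ (by omega)),
      eLpNorm_two_gaussian (hZ _ (by omega)), mul_one]
  have hsum : ∑' k : ℕ, eLpNorm (fun ω => limitTerm d (fun j => Z j ω) (k + 1)) 2 Q ≠ ⊤ := by
    refine ne_top_of_le_ne_top ?_ (ENNReal.tsum_le_tsum hle)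
    rw [ENNReal.tsum_mul_right]
    exact ENNReal.mul_ne_top
      ((summable_geometric_of_lt_one hd0.le hd1).mul_right _).tsum_ofReal_ne_top
      (ENNReal.add_ne_top.2 ⟨enorm_ne_top, ENNReal.one_ne_top⟩)
  filter_upwards [summable_norm_of_tsum_eLpNorm_ne_top one_le_two (fun k => by
    rw [hf]
    exact (((hm _ (by omega)).const_smul _).sub (hm _ (by omega))).const_smul _) hsum] with ω hω
  exact hω.of_norm

end Limit

section Entries

variable {Ω : Type*} [MeasurableSpace Ω] {P : Measure Ω} {β N M : ℕ}
  {H : Ω → Matrix (Fin N) (Fin N) ℝ}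

lemma IsChiBidiagonal.hasLaw_alphaEntry (hH : IsChiBidiagonal P β N M H) {j : ℕ} (hj : j < N) :
    HasLaw (fun ω => alphaEntry (H ω) j) (scaledChiMeasure β M (β * (M - j))) P := by
  simpa [alphaEntry, hj, entryLaw] using hH.hasLaw ⟨j, hj⟩ ⟨j, hj⟩

lemma IsChiBidiagonal.hasLaw_betaEntry (hH : IsChiBidiagonal P β N M H) {j : ℕ}
    (hj : j + 1 < N) :
    HasLaw (fun ω => betaEntry (H ω) j) (scaledChiMeasure β M (β * (N - j - 1))) P := by
  simpa [betaEntry, hj, entryLaw] using hH.hasLaw ⟨j + 1, hj⟩ ⟨j, Nat.lt_of_succ_lt hj⟩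

lemma IsChiBidiagonal.ae_isLowerBidiagonal (hH : IsChiBidiagonal P β N M H) :
    ∀ᵐ ω ∂P, IsLowerBidiagonal (H ω) := by
  unfold IsLowerBidiagonal
  simp only [ae_all_iff, Filter.eventually_imp_distrib_left]
  intro i j h1 h2
  have h := hH.hasLaw i j
  have e : entryLaw β N M i j = Measure.dirac 0 := by simp [entryLaw, h1, h2]
  rw [e] at h
  have h3 : ∀ᵐ x ∂(P.map fun ω => H ω i j), x = 0 := by
    rw [h.map_eq]
    exact (ae_dirac_iff (measurableSet_singleton (0 : ℝ))).2 rfl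
  exact ae_of_ae_map h.aemeasurable h3

lemma measurable_invCorner :
    Measurable fun A : Fin N → Fin N → ℝ => invCorner (Matrix.of A) := by
  have h : (fun A : Fin N → Fin N → ℝ => invCorner (Matrix.of A)) = fun A : Fin N → Fin N → ℝ =>
      (Matrix.of A * (Matrix.of A).transpose).det⁻¹ *
        (firstBasis N ⬝ᵥ (Matrix.of A * (Matrix.of A).transpose).adjugate.mulVec
          (firstBasis N)) := by
    funext A
    rw [invCorner, Matrix.inv_def, Matrix.smul_mulVec, dotProduct_smul, Ring.inverse_eq_inv,
      smul_eq_mul]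
  have hc : Continuous fun A : Fin N → Fin N → ℝ => Matrix.of A * (Matrix.of A).transpose := by
    have : Continuous fun A : Fin N → Fin N → ℝ => Matrix.of A := continuous_id
    exact this.matrix_mul this.matrix_transpose
  rw [h]
  exact hc.matrix_det.measurable.inv.mul
    (continuous_const.dotProduct (hc.matrix_adjugate.matrix_mulVec continuous_const)).measurable

lemma IsChiBidiagonal.aemeasurable_fluctuation (hH : IsChiBidiagonal P β N M H) (n : ℕ) :
    AEMeasurable (fun ω => fluctuation β M (H ω) n) P := by
  have hm : ∀ i j, AEMeasurable (fun ω => H ω i j) P := fun i j => (hH.hasLaw i j).aemeasurable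
  cases n with
  | zero =>
    have h : AEMeasurable (fun ω (i j : Fin N) => H ω i j) P :=
      aemeasurable_pi_iff.2 fun i => aemeasurable_pi_iff.2 fun j => hm i j
    exact ((measurable_invCorner.comp_aemeasurable h).sub_const _).const_mul _
  | succ n =>
    simp only [fluctuation]
    split_ifs
    · refine AEMeasurable.const_mul (AEMeasurable.sub_const ?_ _) _
      unfold alphaEntry
      split_ifs
      · exact hm _ _
      · exact aemeasurable_const
    · refine AEMeasurable.const_mul (AEMeasurable.sub_const ?_ _) _
      unfold betaEntry
      split_ifs
      · exact hm _ _
      · exact aemeasurable_const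

lemma IsChiBidiagonal.iIndepFun_fluctuation (hH : IsChiBidiagonal P β N M H) {n : ℕ}
    (hn : n < N) : iIndepFun (fun (i : Fin n) ω => fluctuation β M (H ω) (i + 1)) P := by
  -- The fluctuation at place `i + 1` is read off from the matrix entry at `q i`.
  let q : Fin n → Fin N × Fin N := fun i =>
    (⟨(i + 1) / 2, by omega⟩, ⟨i / 2, by omega⟩)
  have hq : Function.Injective q := fun i j hij => by
    have h1 := congrArg (fun p => (p.1 : ℕ)) hij
    have h2 := congrArg (fun p => (p.2 : ℕ)) hij
    simp only [q] at h1 h2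
    exact Fin.ext (by omega)
  have h := (hH.indep.precomp hq).comp
    (fun i x => √((β : ℝ) * M) * (x - if (i : ℕ) % 2 = 0 then 1 else √((N : ℝ) / M)))
    (fun i => by fun_prop)
  convert h using 3 with i ω
  simp only [fluctuation, Function.comp, q]
  by_cases hi : (i : ℕ) % 2 = 0
  · have e : ((i : ℕ) + 1) / 2 = i / 2 := by omega
    have hlt : (i : ℕ) / 2 < N := by omega
    simp [hi, alphaEntry, e, hlt]
  · have e : ((i : ℕ) + 1) / 2 = i / 2 + 1 := by omega
    have hlt : (i : ℕ) / 2 + 1 < N := by omega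
    simp [hi, betaEntry, e, hlt]

end Entries

/-! ### The error of the truncation -/

section Tail

variable {β N M : ℕ}

/-- The squares of the entries are within `δ` of their means, from below on the diagonal and from
above on the subdiagonal. -/
def IsTame (M : ℕ) (δ : ℝ) (A : Matrix (Fin N) (Fin N) ℝ) : Prop :=
  (∀ j < N, ((M : ℝ) - j) / M - δ < alphaEntry A j ^ 2) ∧
    ∀ j, j + 1 < N → betaEntry A j ^ 2 < ((N : ℝ) - j - 1) / M + δ

lemma IsTame.le_alphaEntry_sq {δ κ : ℝ} {A : Matrix (Fin N) (Fin N) ℝ} (h : IsTame M δ A)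
    (hM : 0 < M) (hκ : κ ≤ 1 - (N : ℝ) / M - δ) {j : ℕ} (hj : j < N) :
    κ ≤ alphaEntry A j ^ 2 := by
  have hM' : (0 : ℝ) < M := by exact_mod_cast hM
  have h1 := h.1 j hj
  have h2 : (j : ℝ) / M ≤ N / M := by gcongr
  rw [sub_div, div_self hM'.ne'] at h1
  linarith

/-- The ratio of the means `(N - l - 1 + δM) / (M - l - 1 - δM)` decreases in `l`, so that the bound
is needed for the leading ratio only. -/
lemma IsTame.ratio_le {δ κ ρ : ℝ} {A : Matrix (Fin N) (Fin N) ℝ} (h : IsTame M δ A)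
    (hM : 0 < M) (hδ : 0 < δ) (hκ0 : 0 < κ) (hκ : κ ≤ 1 - (N : ℝ) / M - δ) (hρ1 : ρ ≤ 1)
    (hρ : (N : ℝ) / M + 2 * δ ≤ ρ) {l : ℕ} (hl : l + 1 < N) :
    ratio (alphaEntry A) (betaEntry A) l ≤ ρ := by
  have hM' : (0 : ℝ) < M := by exact_mod_cast hM
  have h1 := h.1 (l + 1) hl
  have h2 := h.2 l hl
  have h3 : 0 < alphaEntry A (l + 1) ^ 2 := hκ0.trans_le (h.le_alphaEntry_sq hM hκ hl)
  have hN : (0 : ℝ) ≤ (N : ℝ) / M := by positivity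
  rw [ratio, div_le_iff₀ h3]
  have e1 : ((M : ℝ) - (l + 1 : ℕ)) / M = 1 - (l + 1) / M := by
    rw [sub_div, div_self hM'.ne']; push_cast; ring
  have e2 : ((N : ℝ) - l - 1) / M = N / M - (l + 1) / M := by rw [← sub_div]; ring
  rw [e1] at h1
  rw [e2] at h2
  have hx : (0 : ℝ) ≤ (l + 1) / M := by positivity
  have hρ0 : 0 ≤ ρ := by linarith
  nlinarith [mul_le_mul_of_nonneg_left h1.le hρ0, mul_le_mul_of_nonneg_right hρ1 hx,
    mul_le_mul_of_nonneg_right hρ1 hδ.le]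

variable {Ω : Type*} [MeasurableSpace Ω] {P : Measure Ω} [IsProbabilityMeasure P]
  {H : Ω → Matrix (Fin N) (Fin N) ℝ}

lemma cast_alpha_div (hβ : 0 < β) {j : ℕ} (hj : j ≤ M) :
    ((β * (M - j) : ℕ) : ℝ) / (β * M) = ((M : ℝ) - j) / M := by
  have hβ' : (β : ℝ) ≠ 0 := by positivity
  rw [Nat.cast_mul, Nat.cast_sub hj, mul_div_mul_left _ _ hβ']

lemma cast_beta_div (hβ : 0 < β) {j : ℕ} (hj : j + 1 ≤ N) :
    ((β * (N - j - 1) : ℕ) : ℝ) / (β * M) = ((N : ℝ) - j - 1) / M := by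
  have hβ' : (β : ℝ) ≠ 0 := by positivity
  rw [Nat.cast_mul, Nat.sub_sub, Nat.cast_sub hj, mul_div_mul_left _ _ hβ']
  push_cast
  ring

/-- A union bound over all entries, which is affordable since each single deviation is exponentially
unlikely. -/
lemma IsChiBidiagonal.measureReal_not_isTame_le (hH : IsChiBidiagonal P β N M H) (hβ : 0 < β)
    (hM : 0 < M) (hNM : N ≤ M) {δ : ℝ} (hδ0 : 0 < δ) (hδ1 : δ ≤ 1) :
    P.real {ω | ¬ IsTame M δ (H ω)} ≤ 2 * N * Real.exp (-(δ ^ 2 / 8 * (β * M))) := by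
  have hβM : 0 < (β : ℝ) * M := by positivity
  have hsub : {ω | ¬ IsTame M δ (H ω)} ⊆
      (⋃ j ∈ Finset.range N, {ω | alphaEntry (H ω) j ^ 2 ≤ ((M : ℝ) - j) / M - δ}) ∪
      ⋃ j ∈ Finset.range (N - 1), {ω | ((N : ℝ) - j - 1) / M + δ ≤ betaEntry (H ω) j ^ 2} := by
    intro ω hω
    by_contra hc
    simp only [Set.mem_union, Set.mem_iUnion, Finset.mem_range, Set.mem_ofPred_eq, not_or,
      not_exists, not_le] at hc hω
    exact hω ⟨hc.1, fun j hj => hc.2 j (by omega)⟩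
  refine (measureReal_mono hsub).trans ((measureReal_union_le _ _).trans ?_)
  have h1 := (measureReal_biUnion_finset_le (μ := P) (Finset.range N)
    fun j => {ω | alphaEntry (H ω) j ^ 2 ≤ ((M : ℝ) - j) / M - δ}).trans
      (Finset.sum_le_card_nsmul _ _ (Real.exp (-(δ ^ 2 / 8 * (β * M)))) fun j hj => by
        have hj' := Finset.mem_range.1 hj
        have := measureReal_sq_le (hH.hasLaw_alphaEntry hj') hβM
          (by exact_mod_cast Nat.mul_le_mul_left _ (Nat.sub_le _ _)) hδ0 hδ1
        rwa [cast_alpha_div hβ (by omega)] at this)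
  have h2 := (measureReal_biUnion_finset_le (μ := P) (Finset.range (N - 1))
    fun j => {ω | ((N : ℝ) - j - 1) / M + δ ≤ betaEntry (H ω) j ^ 2}).trans
      (Finset.sum_le_card_nsmul _ _ (Real.exp (-(δ ^ 2 / 8 * (β * M)))) fun j hj => by
        have hj' := Finset.mem_range.1 hj
        have := measureReal_sq_ge (hH.hasLaw_betaEntry (j := j) (by omega)) hβM
          (by exact_mod_cast Nat.mul_le_mul_left _ (by omega)) hδ0 hδ1
        rwa [cast_beta_div hβ (by omega)] at this)
  have h3 : ((N - 1 : ℕ) : ℝ) ≤ N := by exact_mod_cast Nat.sub_le _ _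
  simp only [Finset.card_range, nsmul_eq_mul] at h1 h2
  have h4 := mul_le_mul_of_nonneg_right h3 (Real.exp_pos (-(δ ^ 2 / 8 * (β * M)))).le
  linarith

/-- Bounds the fluctuation of the `l`-th ratio: the sum of the fluctuations of the squares of the
two entries about their means and of the deterministic difference of the means. -/
noncomputable def ratioError (β M : ℕ) (A : Matrix (Fin N) (Fin N) ℝ) (l : ℕ) : ℝ :=
  √((β : ℝ) * M) * |alphaEntry A (l + 1) ^ 2 - ((M : ℝ) - (l + 1 : ℕ)) / M| +
    √((β : ℝ) * M) * |betaEntry A l ^ 2 - ((N : ℝ) - l - 1) / M| + 2 * (l + 1)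

lemma ratioError_nonneg (A : Matrix (Fin N) (Fin N) ℝ) (l : ℕ) : 0 ≤ ratioError β M A l := by
  unfold ratioError; positivity

lemma sqrt_mul_le (hβ : β ≤ 2) (hM : 0 < M) : √((β : ℝ) * M) ≤ 2 * M := by
  have h1 : (β : ℝ) ≤ 2 := by exact_mod_cast hβ
  have h2 : (1 : ℝ) ≤ M := by exact_mod_cast hM
  refine Real.sqrt_le_iff.2 ⟨by positivity, ?_⟩
  nlinarith

/-- The means `(N - l - 1) / M` and `(M - l - 1) / M` of the two squares have ratio `N / M` up to an
error of order `(l + 1) / M`, which is `O(l + 1)` after rescaling. -/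
lemma mul_abs_sub_le_ratioError (hβ : β ≤ 2) (hM : 0 < M) (hNM : N ≤ M)
    (A : Matrix (Fin N) (Fin N) ℝ) (l : ℕ) :
    √((β : ℝ) * M) * |betaEntry A l ^ 2 - (N : ℝ) / M * alphaEntry A (l + 1) ^ 2| ≤
      ratioError β M A l := by
  have hM' : (0 : ℝ) < M := by exact_mod_cast hM
  set s := √((β : ℝ) * M) with hs
  set q := (N : ℝ) / M with hq
  have hs0 : 0 ≤ s := Real.sqrt_nonneg _
  have hq0 : 0 ≤ q := by positivity
  have hq1 : q ≤ 1 := (div_le_one hM').2 (by exact_mod_cast hNM)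
  have e : betaEntry A l ^ 2 - q * alphaEntry A (l + 1) ^ 2 =
      (betaEntry A l ^ 2 - ((N : ℝ) - l - 1) / M) -
        q * (alphaEntry A (l + 1) ^ 2 - ((M : ℝ) - (l + 1 : ℕ)) / M) -
        (1 - q) * ((l + 1) / M) := by
    push_cast
    rw [hq]
    field_simp
    ring
  have h1 : |betaEntry A l ^ 2 - q * alphaEntry A (l + 1) ^ 2| ≤
      |betaEntry A l ^ 2 - ((N : ℝ) - l - 1) / M| +
        |alphaEntry A (l + 1) ^ 2 - ((M : ℝ) - (l + 1 : ℕ)) / M| + (l + 1) / M := by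
    rw [e]
    refine (abs_sub _ _).trans (add_le_add ((abs_sub _ _).trans (add_le_add le_rfl ?_)) ?_)
    · rw [abs_mul, abs_of_nonneg hq0]
      exact mul_le_of_le_one_left (abs_nonneg _) hq1
    · rw [abs_mul, abs_of_nonneg (by linarith), abs_of_nonneg (by positivity)]
      exact mul_le_of_le_one_left (by positivity) (by linarith)
  have h2 : s * ((l + 1) / M) ≤ 2 * (l + 1) := by
    have := sqrt_mul_le hβ hM
    rw [mul_div_assoc', div_le_iff₀ hM']
    have hl : (0 : ℝ) ≤ (l : ℝ) + 1 := by positivity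
    nlinarith
  have h3 := mul_le_mul_of_nonneg_left h1 hs0
  rw [ratioError]
  linarith

lemma IsChiBidiagonal.integrable_ratioError (hH : IsChiBidiagonal P β N M H) (hβ : 0 < β)
    (hM : 0 < M) (hNM : N ≤ M) {l : ℕ} (hl : l + 1 < N) :
    Integrable (fun ω => ratioError β M (H ω) l) P := by
  have hβM : 0 < (β : ℝ) * M := by positivity
  have h1 := integrable_abs_sq_sub (hH.hasLaw_alphaEntry hl) hβM
  have h2 := integrable_abs_sq_sub (hH.hasLaw_betaEntry hl) hβM
  rw [cast_alpha_div hβ (by omega)] at h1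
  rw [cast_beta_div hβ (by omega)] at h2
  exact (h1.add h2).add (integrable_const _)

lemma IsChiBidiagonal.integral_ratioError_le (hH : IsChiBidiagonal P β N M H) (hβ : 0 < β)
    (hM : 0 < M) (hNM : N ≤ M) {l : ℕ} (hl : l + 1 < N) :
    ∫ ω, ratioError β M (H ω) l ∂P ≤ 2 * l + 6 := by
  have hβM : 0 < (β : ℝ) * M := by positivity
  have i1 := integrable_abs_sq_sub (hH.hasLaw_alphaEntry hl) hβM
  have i2 := integrable_abs_sq_sub (hH.hasLaw_betaEntry hl) hβM
  have h1 := integral_abs_sq_sub_le (hH.hasLaw_alphaEntry hl) hβM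
    (by exact_mod_cast Nat.mul_le_mul_left _ (Nat.sub_le _ _))
  have h2 := integral_abs_sq_sub_le (hH.hasLaw_betaEntry hl) hβM
    (by exact_mod_cast Nat.mul_le_mul_left _ (by omega))
  rw [cast_alpha_div hβ (by omega)] at h1 i1
  rw [cast_beta_div hβ (by omega)] at h2 i2
  unfold ratioError
  rw [integral_add (f := fun ω => _ + _) (i1.add i2) (integrable_const _), integral_add i1 i2]
  have h3 : √2 ≤ 2 := Real.sqrt_le_iff.2 (by norm_num)
  simp only [integral_const, probReal_univ, one_smul]
  linarith

/-- Bounds the probability that the truncation of the corner entry after `L` terms is off by `ε`: off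
the exponentially small event where some entry is atypical, the error is at most a variable whose
expectation is a geometric tail, and Markov's inequality applies. -/
lemma IsChiBidiagonal.measureReal_corner_sub_truncCorner_le (hH : IsChiBidiagonal P β N M H)
    (hβ0 : 0 < β) (hβ : β ≤ 2) (hM : 0 < M) (hNM : N ≤ M) {L : ℕ} (hL : L < N)
    {δ κ ρ C ε : ℝ} (hδ0 : 0 < δ) (hδ1 : δ ≤ 1) (hκ0 : 0 < κ)
    (hκ : κ ≤ 1 - (N : ℝ) / M - δ) (hρ1 : ρ < 1) (hρ : (N : ℝ) / M + 2 * δ ≤ ρ)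
    (hC : 1 / (1 - (N : ℝ) / M) ≤ C) (hε : 0 < ε) {v : Ω → ℕ → ℝ}
    (hv : ∀ ω, ∀ j ≤ 2 * L, v ω j = fluctuation β M (H ω) (j + 1)) :
    P.real {ω | ε ≤ |fluctuation β M (H ω) 0 -
      truncCorner κ L (v ω) (√((β : ℝ) * M))⁻¹ (√((N : ℝ) / M)) (1 / (1 - (N : ℝ) / M))|} ≤
    2 * N * Real.exp (-(δ ^ 2 / 8 * (β * M))) +
      κ⁻¹ * C * (κ⁻¹ * ∑' l : ℕ, ρ ^ (l + L) * (2 * ((l + L : ℕ) : ℝ) + 6) +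
        √((β : ℝ) * M) * ρ ^ (N - 1)) / ε := by
  set s := √((β : ℝ) * M) with hs
  set q := (N : ℝ) / M with hq
  have hM' : (0 : ℝ) < M := by exact_mod_cast hM
  have hs0 : 0 < s := Real.sqrt_pos.2 (by positivity)
  have hq0 : 0 ≤ q := by positivity
  have hσ : √q ^ 2 = q := Real.sq_sqrt hq0
  have hq1 : 0 < 1 - q := by linarith
  have hρ0 : 0 ≤ ρ := by linarith
  have hc1 : 1 ≤ 1 / (1 - q) := by rw [le_div_iff₀ hq1]; linarith
  have hC0 : 0 ≤ C := by linarith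
  obtain ⟨n, rfl⟩ : ∃ n, N = n + 1 := ⟨N - 1, by omega⟩
  -- The error bound of `abs_corner_sub_truncCorner_le`.
  set R : Ω → ℝ := fun ω => κ⁻¹ * C * (∑ l ∈ Finset.Ico L n,
    ρ ^ l * (κ⁻¹ * ratioError β M (H ω) l) + s * ρ ^ n) with hR
  have hRint : Integrable R P := by
    refine Integrable.const_mul (Integrable.add (integrable_finsetSum _ fun l hl => ?_)
      (integrable_const _)) _
    have hl' := (Finset.mem_Ico.1 hl).2
    exact ((hH.integrable_ratioError hβ0 hM hNM (by omega)).const_mul _).const_mul _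
  have hR0 : ∀ ω, 0 ≤ R ω := fun ω => by
    have : ∀ l, 0 ≤ ratioError β M (H ω) l := fun l => ratioError_nonneg _ l
    have : 0 ≤ ∑ l ∈ Finset.Ico L n, ρ ^ l * (κ⁻¹ * ratioError β M (H ω) l) :=
      Finset.sum_nonneg fun l _ => mul_nonneg (by positivity) (mul_nonneg (by positivity) (this l))
    simp only [hR]
    positivity
  have hsumm : Summable fun l : ℕ => ρ ^ l * (2 * (l : ℝ) + 6) := by
    have h1 := summable_pow_mul_geometric_of_norm_lt_one (R := ℝ) 1
      (r := ρ) (by rwa [Real.norm_of_nonneg hρ0])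
    have h2 := summable_geometric_of_lt_one hρ0 hρ1
    refine ((h1.mul_left 2).add (h2.mul_left 6)).congr fun l => ?_
    ring
  have hRle : ∫ ω, R ω ∂P ≤ κ⁻¹ * C *
      (κ⁻¹ * ∑' l : ℕ, ρ ^ (l + L) * (2 * ((l + L : ℕ) : ℝ) + 6) + s * ρ ^ n) := by
    simp only [hR]
    rw [integral_const_mul, integral_add (integrable_finsetSum _ fun l hl => by
      have hl' := (Finset.mem_Ico.1 hl).2
      exact ((hH.integrable_ratioError hβ0 hM hNM (by omega)).const_mul _).const_mul _)
      (integrable_const _), integral_finsetSum _ fun l hl => by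
      have hl' := (Finset.mem_Ico.1 hl).2
      exact ((hH.integrable_ratioError hβ0 hM hNM (by omega)).const_mul _).const_mul _]
    simp only [integral_const, probReal_univ, one_smul]
    gcongr
    calc ∑ l ∈ Finset.Ico L n, ∫ ω, ρ ^ l * (κ⁻¹ * ratioError β M (H ω) l) ∂P
        ≤ ∑ l ∈ Finset.Ico L n, κ⁻¹ * (ρ ^ l * (2 * (l : ℝ) + 6)) := by
          refine Finset.sum_le_sum fun l hl => ?_
          have hl' := (Finset.mem_Ico.1 hl).2
          rw [integral_const_mul, integral_const_mul, mul_left_comm]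
          have := hH.integral_ratioError_le hβ0 hM hNM (l := l) (by omega)
          gcongr
      _ = κ⁻¹ * ∑ l ∈ Finset.range (n - L), ρ ^ (l + L) * (2 * ((l + L : ℕ) : ℝ) + 6) := by
          rw [← Finset.mul_sum, Finset.sum_Ico_eq_sum_range]
          simp only [add_comm L]
      _ ≤ _ := by
          gcongr
          exact ((summable_nat_add_iff L).2 hsumm).sum_le_tsum _ fun l _ => by positivity
  have hmarkov : P.real {ω | ε ≤ R ω} ≤ κ⁻¹ * C *
      (κ⁻¹ * ∑' l : ℕ, ρ ^ (l + L) * (2 * ((l + L : ℕ) : ℝ) + 6) + s * ρ ^ n) / ε := by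
    rw [le_div_iff₀ hε, mul_comm]
    exact (mul_meas_ge_le_integral_of_nonneg (ae_of_all _ hR0) hRint ε).trans hRle
  have hnull : P.real {ω | ¬ IsLowerBidiagonal (H ω)} = 0 := by
    rw [measureReal_def, ae_iff.1 hH.ae_isLowerBidiagonal, ENNReal.toReal_zero]
  refine (measureReal_mono (s₂ := ({ω | ¬ IsTame M δ (H ω)} ∪ {ω | ε ≤ R ω}) ∪
    {ω | ¬ IsLowerBidiagonal (H ω)}) ?_).trans ?_
  · intro ω hω
    by_contra hcon
    simp only [Set.mem_union, Set.mem_ofPred_eq, not_or, not_not, not_le] at hcon hω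
    obtain ⟨⟨ht, hRω⟩, hlow⟩ := hcon
    have ha : ∀ j < n + 1, κ ≤ alphaEntry (H ω) j ^ 2 := fun j hj => ht.le_alphaEntry_sq hM hκ hj
    have hva : ∀ j ≤ L, v ω (2 * j) = s * (alphaEntry (H ω) j - 1) := fun j hj => by
      rw [hv ω _ (by omega)]
      simp [fluctuation, hs]
    have hvb : ∀ j < L, v ω (2 * j + 1) = s * (betaEntry (H ω) j - √q) := fun j hj => by
      rw [hv ω _ (by omega)]
      have e1 : (2 * j + 1) % 2 = 1 := by omega
      have e2 : (2 * j + 1) / 2 = j := by omega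
      simp [fluctuation, hs, hq, e1, e2]
    have hmain := abs_corner_sub_truncCorner_le (c := 1 / (1 - q)) (C := C) (ρ := ρ) hκ0 hs0
      (by rw [hσ]; field_simp) (by rwa [abs_of_nonneg (by linarith)])
      (by rw [abs_sub_comm, abs_of_nonneg (by linarith)]; linarith)
      (Nat.le_of_lt_succ hL) (fun j hj => ha j (Nat.lt_succ_of_le hj))
      (fun l hl => ht.ratio_le hM hδ0 hκ0 hκ hρ1.le hρ (Nat.succ_lt_succ hl)) hva hvb
    rw [hσ] at hmain
    have hinv := invCorner_eq hlow fun j hj h0 => by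
      have := ha j hj
      rw [h0] at this
      norm_num at this
      linarith
    have hf : fluctuation β M (H ω) 0 = s * (invCorner (H ω) - 1 / (1 - q)) := rfl
    rw [hf, hinv] at hω
    refine absurd (hω.trans hmain) (not_le.2 (lt_of_le_of_lt ?_ hRω))
    simp only [hR]
    gcongr with l hl
    exact mul_abs_sub_le_ratioError hβ hM hNM _ l
  · refine (measureReal_union_le _ _).trans ?_
    rw [hnull, add_zero]
    refine (measureReal_union_le _ _).trans (add_le_add ?_ hmarkov)
    exact hH.measureReal_not_isTame_le hβ0 hM hNM hδ0 hδ1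

end Tail

/-! ### Convergence of the fluctuations -/

section Assembly

/-- Extension of a finite sequence by zero. -/
def extendZero {n : ℕ} (v : Fin n → ℝ) (j : ℕ) : ℝ := if h : j < n then v ⟨j, h⟩ else 0

lemma continuous_extendZero {n : ℕ} : Continuous (extendZero (n := n)) := by
  refine continuous_pi fun j => ?_
  unfold extendZero
  split_ifs
  · exact continuous_apply _
  · exact continuous_const

/-- The coordinates in `S` of the vector with entry `truncCorner` at place `0` and the fluctuations
of the matrix entries at the later places. -/
noncomputable def truncVector (S : Finset ℕ) (κ : ℝ) (L : ℕ) (v : ℕ → ℝ) (ε σ c : ℝ) (i : S) : ℝ :=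
  if (i : ℕ) = 0 then truncCorner κ L v ε σ c else v (i - 1)

lemma continuous_truncVector (S : Finset ℕ) {κ : ℝ} (hκ : 0 < κ) (L n : ℕ) :
    Continuous fun p : (Fin n → ℝ) × ℝ × ℝ × ℝ =>
      truncVector S κ L (extendZero p.1) p.2.1 p.2.2.1 p.2.2.2 := by
  have he : Continuous fun p : (Fin n → ℝ) × ℝ × ℝ × ℝ => extendZero p.1 :=
    continuous_extendZero.comp continuous_fst
  refine continuous_pi fun i => ?_
  unfold truncVector
  split_ifs
  · exact (continuous_truncCorner hκ L).comp (he.prodMk continuous_snd)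
  · exact (continuous_apply ((i : ℕ) - 1)).comp he

/-- At the limiting fluctuations, the truncated corner entries are the partial sums of the limiting
series. -/
lemma tendsto_truncCorner_limit {d κ : ℝ} (hd0 : 0 < d) (hκ : κ ≤ 1) {z : ℕ → ℝ}
    (hz : Summable fun k : ℕ => limitTerm d z (k + 1)) {v : ℕ → ℕ → ℝ}
    (hv : ∀ L, ∀ j ≤ 2 * L, v L j = z (j + 1) / √2) :
    Tendsto (fun L => truncCorner κ L (v L) 0 (√d) (1 / (1 - d))) atTop (𝓝 (limitCorner d z)) := by
  have h2 : 2 / √2 = √2 := Real.div_sqrt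
  have hd : d / √d = √d := Real.div_sqrt
  have e : ∀ L, truncCorner κ L (v L) 0 (√d) (1 / (1 - d)) =
      -√2 * (z 1 / (1 - d)) + √2 * ∑ k ∈ Finset.range L, limitTerm d z (k + 1) := fun L => by
    rw [truncCorner_zero hκ, hv L 0 (Nat.zero_le _), mul_add, Finset.mul_sum, Finset.mul_sum]
    congr 1
    · have : 2 * (z (0 + 1) / √2) = √2 * z 1 := by
        rw [zero_add, ← mul_div_assoc, mul_div_right_comm, h2]
      rw [this]
      ring
    · refine Finset.sum_congr rfl fun l hl => ?_
      have hl' := Finset.mem_range.1 hl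
      rw [hv L _ (by omega), hv L _ (by omega), Real.sq_sqrt hd0.le, limitTerm,
        show 2 * (l + 1) = 2 * l + 1 + 1 by ring, show 2 * l + 2 + 1 = 2 * l + 1 + 1 + 1 by ring]
      have h3 : 2 * √d * (z (2 * l + 1 + 1) / √2) = √2 * (d * (z (2 * l + 1 + 1) / √d)) := by
        linear_combination √d * z (2 * l + 1 + 1) * h2 - √2 * z (2 * l + 1 + 1) * hd
      have h4 : 2 * d * (z (2 * l + 1 + 1 + 1) / √2) = √2 * (d * z (2 * l + 1 + 1 + 1)) := by
        linear_combination d * z (2 * l + 1 + 1 + 1) * h2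
      rw [h3, h4, pow_succ]
      ring
  simp only [e]
  exact tendsto_const_nhds.add (hz.hasSum.tendsto_sum_nat.const_mul _)

variable {β : ℕ} {d : ℝ} {N : ℕ → ℕ}

lemma eventually_half_mul_le (hd0 : 0 < d)
    (hN : Tendsto (fun M : ℕ => (N M : ℝ) / M) atTop (𝓝 d)) :
    ∀ᶠ M : ℕ in atTop, d / 2 * M ≤ N M := by
  filter_upwards [hN.eventually_const_le (half_lt_self hd0), eventually_gt_atTop 0] with M hM hM0
  exact (le_div_iff₀ (by exact_mod_cast hM0)).1 hM

lemma tendsto_dim_atTop (hd0 : 0 < d)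
    (hN : Tendsto (fun M : ℕ => (N M : ℝ) / M) atTop (𝓝 d)) : Tendsto N atTop atTop := by
  refine (tendsto_natCast_atTop_iff (R := ℝ)).1 ?_
  exact tendsto_atTop_mono' _ (eventually_half_mul_le hd0 hN)
    (tendsto_natCast_atTop_atTop.const_mul_atTop (by positivity))

/-- The part of the geometric series beyond the size of the matrix is negligible on the scale
`√(βM)`, as `N` grows linearly in `M`. -/
lemma tendsto_sqrt_mul_pow_dim (hβ : β ≤ 2) (hd0 : 0 < d)
    (hN : Tendsto (fun M : ℕ => (N M : ℝ) / M) atTop (𝓝 d)) {ρ : ℝ} (hρ0 : 0 < ρ) (hρ1 : ρ < 1) :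
    Tendsto (fun M : ℕ => √((β : ℝ) * M) * ρ ^ (N M - 1)) atTop (𝓝 0) := by
  have hNt := tendsto_dim_atTop hd0 hN
  have h := ((tendsto_self_mul_const_pow_of_lt_one hρ0.le hρ1).comp hNt).const_mul (4 / d / ρ)
  rw [mul_zero] at h
  refine squeeze_zero' (Eventually.of_forall fun M => by positivity) ?_ h
  filter_upwards [eventually_half_mul_le hd0 hN, eventually_gt_atTop 0,
    hNt.eventually_ge_atTop 1] with M h1 h2 h3
  have h4 := sqrt_mul_le hβ h2
  have h5 : ρ ^ N M = ρ ^ (N M - 1) * ρ := by rw [← pow_succ, Nat.sub_add_cancel h3]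
  have h6 : √((β : ℝ) * M) ≤ 4 / d * N M := by
    rw [div_mul_eq_mul_div, le_div_iff₀ hd0]
    nlinarith
  simp only [Function.comp]
  calc √((β : ℝ) * M) * ρ ^ (N M - 1) ≤ 4 / d * N M * ρ ^ (N M - 1) := by gcongr
    _ = 4 / d / ρ * (N M * ρ ^ N M) := by rw [h5]; field_simp

lemma tendsto_dim_mul_exp (hβ : 0 < β) (hNM : ∀ M, N M ≤ M) {δ : ℝ} (hδ : 0 < δ) :
    Tendsto (fun M : ℕ => 2 * (N M : ℝ) * Real.exp (-(δ ^ 2 / 8 * (β * M)))) atTop (𝓝 0) := by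
  have hβ' : (0 : ℝ) < β := by exact_mod_cast hβ
  have h := (tendsto_self_mul_const_pow_of_lt_one (r := Real.exp (-(δ ^ 2 / 8 * β)))
    (Real.exp_pos _).le (Real.exp_lt_one_iff.2 (by
      have : 0 < δ ^ 2 / 8 * β := by positivity
      linarith))).const_mul 2
  rw [mul_zero] at h
  refine squeeze_zero (fun M => by positivity) (fun M => ?_) h
  have h1 : (N M : ℝ) ≤ M := by exact_mod_cast hNM M
  have e : Real.exp (-(δ ^ 2 / 8 * β)) ^ M = Real.exp (-(δ ^ 2 / 8 * (β * M))) := by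
    rw [← Real.exp_nat_mul]; congr 1; ring
  rw [e, mul_assoc]
  gcongr

variable {Ω : ℕ → Type*} [∀ M, MeasurableSpace (Ω M)] {P : ∀ M, Measure (Ω M)}
  [∀ M, IsProbabilityMeasure (P M)] {H : ∀ M, Ω M → Matrix (Fin (N M)) (Fin (N M)) ℝ}
  {Ω' : Type*} [MeasurableSpace Ω'] {Q : Measure Ω'} [IsProbabilityMeasure Q]

/-- The fluctuation of each matrix entry converges to a normal variable with variance `1 / 2`. -/
lemma tendstoInDistribution_entry (hβ : 0 < β) (hd0 : 0 < d)
    (hN : Tendsto (fun M : ℕ => (N M : ℝ) / M) atTop (𝓝 d))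
    (hH : ∀ M, IsChiBidiagonal (P M) β (N M) M (H M)) {Y : Ω' → ℝ}
    (hY : HasLaw Y (gaussianReal 0 1) Q) (i : ℕ) :
    TendstoInDistribution (fun M ω => fluctuation β M (H M ω) (i + 1)) atTop
      (fun ω => Y ω / √2) P Q := by
  have hNt := tendsto_dim_atTop hd0 hN
  have hY2 : HasLaw (fun ω => Y ω / √2) (gaussianReal 0 (1 / 2)) Q := by
    convert gaussianReal_div_const hY (√2) using 2
    · simp
    · ext; simp
  have hm := fun M => (hH M).aemeasurable_fluctuation (i + 1)
  by_cases hi : i % 2 = 0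
  · refine tendstoInDistribution_chi hm (k := fun M => β * (M - i / 2)) (m := fun M => β * M)
      (D := β * (i / 2)) ?_ ?_ ?_ hY2
    · exact (tendsto_sub_atTop_nat (i / 2)).const_mul_atTop' hβ
    · filter_upwards [eventually_ge_atTop (i / 2)] with M hM
      refine ⟨Nat.mul_le_mul_left _ (Nat.sub_le _ _), ?_⟩
      rw [← mul_add, Nat.sub_add_cancel hM]
    · filter_upwards [hNt.eventually_gt_atTop (i / 2), eventually_gt_atTop 0] with M hM hM0
      have := hasLaw_sqrt_mul_sub ((hH M).hasLaw_alphaEntry hM) (by positivity) (√(β * M : ℕ))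
      convert this using 2 with ω
      simp only [fluctuation, hi, if_true]
      push_cast
      ring
  · refine tendstoInDistribution_chi hm (k := fun M => β * (N M - i / 2 - 1))
      (m := fun M => β * N M) (D := β * (i / 2 + 1)) ?_ ?_ ?_ hY2
    · simp only [Nat.sub_sub]
      exact ((tendsto_sub_atTop_nat (i / 2 + 1)).comp hNt).const_mul_atTop' hβ
    · filter_upwards [hNt.eventually_ge_atTop (i / 2 + 1)] with M hM
      refine ⟨Nat.mul_le_mul_left _ (by omega), ?_⟩
      rw [← mul_add, Nat.sub_sub, Nat.sub_add_cancel hM]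
    · filter_upwards [hNt.eventually_gt_atTop (i / 2 + 1), eventually_gt_atTop 0] with M hM hM0
      have := hasLaw_sqrt_mul_sub ((hH M).hasLaw_betaEntry hM) (by positivity) (√(β * N M : ℕ))
      convert this using 2 with ω
      have e : √((β : ℝ) * M) * √((N M : ℝ) / M) = √(β * N M : ℕ) := by
        rw [← Real.sqrt_mul (by positivity)]
        congr 1
        push_cast
        field_simp
      simp only [fluctuation, hi, if_false]
      rw [mul_sub, e]

lemma tendstoInDistribution_entries (hβ : 0 < β) (hd0 : 0 < d)
    (hN : Tendsto (fun M : ℕ => (N M : ℝ) / M) atTop (𝓝 d))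
    (hH : ∀ M, IsChiBidiagonal (P M) β (N M) M (H M)) {Z : ℕ → Ω' → ℝ}
    (hZlaw : ∀ j, 1 ≤ j → HasLaw (Z j) (gaussianReal 0 1) Q)
    (hZindep : iIndepFun (fun j => Z (j + 1)) Q) (n : ℕ) :
    TendstoInDistribution (fun M ω (i : Fin n) => fluctuation β M (H M ω) (i + 1)) atTop
      (fun ω (i : Fin n) => Z (i + 1) ω / √2) P Q := by
  refine tendstoInDistribution_pi
    (fun i => tendstoInDistribution_entry hβ hd0 hN hH (hZlaw _ (Nat.le_add_left _ _)) i) ?_ ?_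
  · filter_upwards [(tendsto_dim_atTop hd0 hN).eventually_gt_atTop n] with M hM
    exact (hH M).iIndepFun_fluctuation hM
  · exact (hZindep.precomp (g := fun i : Fin n => (i : ℕ)) Fin.val_injective).comp
      (fun _ x => x / √2) (by fun_prop)

/-- Joint convergence of the fluctuations of the corner entry and the matrix entries. -/
theorem tendstoInDistribution_fluctuation (hβ0 : 0 < β) (hβ : β ≤ 2) (hd0 : 0 < d) (hd1 : d < 1)
    (hNM : ∀ M, N M ≤ M) (hN : Tendsto (fun M : ℕ => (N M : ℝ) / M) atTop (𝓝 d))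
    (hH : ∀ M, IsChiBidiagonal (P M) β (N M) M (H M)) {Z : ℕ → Ω' → ℝ}
    (hZlaw : ∀ j, 1 ≤ j → HasLaw (Z j) (gaussianReal 0 1) Q)
    (hZindep : iIndepFun (fun j => Z (j + 1)) Q) (S : Finset ℕ) :
    TendstoInDistribution (fun M ω (i : S) => fluctuation β M (H M ω) i) atTop
      (fun ω (i : S) => limitVector d (fun j => Z j ω) i) P Q := by
  have hNt := tendsto_dim_atTop hd0 hN
  -- Once `N / M ≤ d + (1 - d) / 4`, these constants satisfy `κ ≤ 1 - N / M - δ`,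
  -- `N / M + 2δ ≤ ρ < 1` and `1 / (1 - N / M) ≤ C`.
  set κ := (1 - d) / 2 with hκ
  set δ := (1 - d) / 8 with hδ
  set ρ := (1 + d) / 2 with hρ
  set C := 2 / (1 - d) with hC
  have h1d : 0 < 1 - d := by linarith
  have hκ0 : 0 < κ := by positivity
  -- The truncation after `L` terms needs the first `2L + 1` entries, the coordinates in `S` need
  -- at most `S.sup id`.
  obtain ⟨n, hn⟩ : ∃ n : ℕ → ℕ, ∀ L, n L = 2 * L + 1 + S.sup id := ⟨_, fun _ => rfl⟩
  let U : ℕ → ∀ M, Ω M → S → ℝ := fun L M ω => truncVector S κ L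
    (extendZero fun i : Fin (n L) => fluctuation β M (H M ω) (i + 1))
    (√((β : ℝ) * M))⁻¹ (√((N M : ℝ) / M)) (1 / (1 - (N M : ℝ) / M))
  let T : ℕ → Ω' → S → ℝ := fun L ω => truncVector S κ L
    (extendZero fun i : Fin (n L) => Z (i + 1) ω / √2) 0 (√d) (1 / (1 - d))
  have hU : ∀ L, TendstoInDistribution (U L) atTop (T L) P Q := fun L => by
    have hs : Tendsto (fun M : ℕ => (√((β : ℝ) * M))⁻¹) atTop (𝓝 0) :=
      tendsto_inv_atTop_zero.comp (Real.tendsto_sqrt_atTop.comp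
        (tendsto_natCast_atTop_atTop.const_mul_atTop (by exact_mod_cast hβ0)))
    have hσ : Tendsto (fun M : ℕ => √((N M : ℝ) / M)) atTop (𝓝 (√d)) := hN.sqrt
    have hc : Tendsto (fun M : ℕ => 1 / (1 - (N M : ℝ) / M)) atTop (𝓝 (1 / (1 - d))) :=
      tendsto_const_nhds.div (tendsto_const_nhds.sub hN) h1d.ne'
    exact (tendstoInDistribution_prodMk_const
      (tendstoInDistribution_entries hβ0 hd0 hN hH hZlaw hZindep (n L))
      (hs.prodMk_nhds (hσ.prodMk_nhds hc))).continuous_comp (continuous_truncVector S hκ0 L (n L))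
  have hext : ∀ (L : ℕ) (w : ℕ → ℝ), ∀ j < n L, extendZero (fun i : Fin (n L) => w i) j = w j :=
    fun L w j hj => by simp [extendZero, hj]
  have hmem : ∀ (L : ℕ) (i : S), (i : ℕ) ≠ 0 → (i : ℕ) - 1 < n L := fun L i hi => by
    have : (i : ℕ) ≤ S.sup id := Finset.le_sup (f := id) i.2
    have := hn L
    omega
  -- Only the coordinate `0` depends on `L`.
  have hT : ∀ᵐ ω ∂Q, Tendsto (fun L => T L ω) atTop
      (𝓝 fun i : S => limitVector d (fun j => Z j ω) i) := by
    filter_upwards [ae_summable_limitTerm hd0 hd1 hZlaw] with ω hω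
    refine tendsto_pi_nhds.2 fun i => ?_
    by_cases hi : (i : ℕ) = 0
    · simp only [T, truncVector, hi, if_true, limitVector]
      exact tendsto_truncCorner_limit hd0 (by linarith) hω fun L j hj =>
        hext L (fun i => Z (i + 1) ω / √2) j (by have := hn L; omega)
    · obtain ⟨k, hk⟩ := Nat.exists_eq_succ_of_ne_zero hi
      have e : ∀ L, T L ω i = limitVector d (fun j => Z j ω) i := fun L => by
        simp only [T, truncVector, hi, if_false]
        rw [hext L (fun i => Z (i + 1) ω / √2) _ (hmem L i hi), hk]
        rfl
      simp only [e]
      exact tendsto_const_nhds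
  refine tendstoInDistribution_of_approx (U := U) (T := T)
    (fun M => aemeasurable_pi_iff.2 fun i => (hH M).aemeasurable_fluctuation i)
    ?_ hU hT ?_
  · exact aemeasurable_of_tendsto_metrizable_ae atTop (fun L => (hU L).aemeasurable_limit) hT
  · intro ε hε
    set τ : ℕ → ℝ := fun L => ∑' l : ℕ, ρ ^ (l + L) * (2 * ((l + L : ℕ) : ℝ) + 6) with hτ
    have hτ0 : Tendsto τ atTop (𝓝 0) :=
      tendsto_sum_nat_add fun l : ℕ => ρ ^ l * (2 * (l : ℝ) + 6)
    have hlim : Tendsto (fun L => 0 + κ⁻¹ * C * (κ⁻¹ * τ L + 0) / ε) atTop (𝓝 0) := by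
      have := (((hτ0.const_mul κ⁻¹).add_const 0).const_mul (κ⁻¹ * C)).div_const ε
      simpa using this
    filter_upwards [hlim.eventually_lt_const hε] with L hL
    have hbound : Tendsto (fun M : ℕ => 2 * (N M : ℝ) * Real.exp (-(δ ^ 2 / 8 * (β * M))) +
        κ⁻¹ * C * (κ⁻¹ * τ L + √((β : ℝ) * M) * ρ ^ (N M - 1)) / ε) atTop
        (𝓝 (0 + κ⁻¹ * C * (κ⁻¹ * τ L + 0) / ε)) :=
      (tendsto_dim_mul_exp hβ0 hNM (by positivity)).add
        (((tendsto_const_nhds.add (tendsto_sqrt_mul_pow_dim hβ hd0 hN (by positivity)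
          (by linarith))).const_mul _).div_const _)
    filter_upwards [hbound.eventually_lt_const hL, eventually_gt_atTop 0,
      hNt.eventually_gt_atTop L,
      hN.eventually_le_const (show d < d + (1 - d) / 4 by linarith)] with M h1 hM0 hML hq
    refine le_trans ?_ h1.le
    refine le_trans (measureReal_mono ?_) ((hH M).measureReal_corner_sub_truncCorner_le hβ0 hβ hM0
      (hNM M) hML (δ := δ) (κ := κ) (ρ := ρ) (C := C) (ε := ε)
      (v := fun ω => extendZero fun i : Fin (n L) => fluctuation β M (H M ω) (i + 1))
      (by positivity) (by linarith) hκ0 (by linarith) (by linarith) (by linarith) ?_ hε ?_)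
    · intro ω hω
      simp only [Set.mem_ofPred_eq] at hω ⊢
      by_contra hcon
      refine absurd hω (not_le.2 ((dist_pi_lt_iff hε).2 fun i => ?_))
      by_cases hi : (i : ℕ) = 0
      · simp only [U, truncVector, hi, if_true]
        rw [dist_comm]
        exact not_le.1 hcon
      · have e : U L M ω i = fluctuation β M (H M ω) i := by
          simp only [U, truncVector, hi, if_false]
          rw [hext L (fun i => fluctuation β M (H M ω) (i + 1)) _ (hmem L i hi),
            Nat.sub_add_cancel (Nat.one_le_iff_ne_zero.2 hi)]
        rw [e, dist_self]
        exact hε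
    · have h2 : (1 - d) / 2 ≤ 1 - (N M : ℝ) / M := by linarith
      calc 1 / (1 - (N M : ℝ) / M) ≤ 1 / ((1 - d) / 2) := one_div_le_one_div_of_le hκ0 h2
        _ = C := by rw [hC]; field_simp
    · exact fun ω j hj => hext L (fun i => fluctuation β M (H M ω) (i + 1)) j (by have := hn L; omega)

end Assembly

end Bidiagonal

theorem proposition4p4
    (β : ℕ) (hβ : β = 1 ∨ β = 2)
    (d : ℝ) (hd0 : 0 < d) (hd1 : d < 1)
    (N : ℕ → ℕ) (hNM : ∀ M, N M ≤ M)
    (hN : Tendsto (fun M : ℕ => (N M : ℝ) / M) atTop (𝓝 d))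
    {Ω : ℕ → Type*} [∀ M, MeasurableSpace (Ω M)]
    (P : ∀ M, Measure (Ω M)) [∀ M, IsProbabilityMeasure (P M)]
    (H : ∀ M, Ω M → Matrix (Fin (N M)) (Fin (N M)) ℝ)
    (hH : ∀ M, Bidiagonal.IsChiBidiagonal (P M) β (N M) M (H M))
    {Ω' : Type*} [MeasurableSpace Ω'] (Q : Measure Ω') [IsProbabilityMeasure Q]
    (Z : ℕ → Ω' → ℝ)
    (hZlaw : ∀ j, 1 ≤ j → HasLaw (Z j) (gaussianReal 0 1) Q)
    (hZindep : iIndepFun (fun j => Z (j + 1)) Q) :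
    (∀ᵐ ω ∂Q, Summable (fun k : ℕ => Bidiagonal.limitTerm d (fun j => Z j ω) (k + 1))) ∧
    TendstoInDistribution
      (fun (M : ℕ) (ω : Ω M) =>
        √((β : ℝ) * M) * (Bidiagonal.invCorner (H M ω) - 1 / (1 - (N M : ℝ) / M)))
      atTop
      (fun ω => Bidiagonal.limitCorner d (fun j => Z j ω)) P Q ∧
    ∀ S : Finset ℕ,
      TendstoInDistribution
        (fun (M : ℕ) (ω : Ω M) (n : S) => Bidiagonal.fluctuation β M (H M ω) n)
        atTop
        (fun ω (n : S) => Bidiagonal.limitVector d (fun j => Z j ω) n) P Q := by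
  have hβ0 : 0 < β := by omega
  have hβ2 : β ≤ 2 := by omega
  have hS := Bidiagonal.tendstoInDistribution_fluctuation hβ0 hβ2 hd0 hd1 hNM hN hH hZlaw hZindep
  refine ⟨Bidiagonal.ae_summable_limitTerm hd0 hd1 hZlaw, ?_, hS⟩
  exact (hS {0}).continuous_comp (g := fun x : ({0} : Finset ℕ) → ℝ => x ⟨0, by simp⟩)
    (continuous_apply _)
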